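/- Let $k$ be an odd positive integer, let $\chi$ be a non-principal primitive Dirichlet character modulo $k$, and let $\bar\chi$ be its complex conjugate. Let $G(\chi)=\sum_{v=0}^{k-1}\chi(v)e^{2\pi i v/k}$. For $\operatorname{Im} z>0$ and $s\in\mathbb{C}$ put $$A_1(z,s:\chi)=\sum_{n=1}^\infty\sum_{m=1}^\infty \chi(n)\chi(m)(-1)^m n^{s-1}e^{2\pi i mnz/k},\qquad B(z,s:\chi)=\sum_{n=0}^\infty\sum_{m=1}^\infty\chi(m)\chi(2n+1)(2n+1)^{s-1}e^{\pi i m(2n+1)z/k},$$ $$H_1(z,s:\chi)=(1+e^{\pi i s})A_1(z,s:\chi),\qquad B_1(z,s:\chi)=(1+e^{\pi i s})B(z,s:\chi).$$ Let $a,b,c,d$ be integers with $ad-bc=1$, $c>0$ and $d$ even; let $Tz=(az+b)/(cz+d)$ and $\mathbb{K}=\{x+iy: x>-d/c,\ y>0\}$. Write $[x]$ and $\{x\}$ for the integer and fractional parts of a real number $x$. For integers $1\le j\le c$ and $0\le\mu,\nu\le k-1$ (on which $f$ depends, although this is not shown in the notation) put $$f(z,s,c,d)=\int_C \frac{e^{-(\mu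 c+j)(cz+d)u/c}}{e^{-(cz+d)ku}-1}\,\frac{e^{(\nu+\{dj/c\})u}}{e^{ku}-1}\,u^{s-1}\,du,$$ where $u^{s-1}$ is taken on the branch $0<\arg u<2\pi$ and $C=C_\delta$ is the loop that comes in from $+\infty$ along $\operatorname{Im}u=\delta$, $\operatorname{Re}u\ge 0$, goes around the origin in the positive direction along the left half of the circle $|u|=\delta$, and returns to $+\infty$ along $\operatorname{Im}u=-\delta$, $\operatorname{Re}u\ge0$; here $\delta>0$ is any number such that $u=0$ is the only zero of $(e^{-(cz+d)ku}-1)(e^{ku}-1)$ on or inside $C_\delta$. (Every sufficiently small $\delta>0$ has this property when $\operatorname{Re}(cz+d)>0$. The loops used for $f(z,s,c,d)$ and for $f(z/2,s,c,d/2)$ may be different.) Powers of complex numbers other than $u$ are principal. Then for all $z\in\mathbb{K}$ and all $s\in\mathbb{C}$ the double series for $A_1(Tz,s:\chi)$, $B(z,s:\chi)$, $B(z,s:\bar\chi)$ and the integrals $f(z,s,c,d)$, $f(z/2,s,c,d/2)$ converge absolutely, and the following hold. (i) If $a\equiv d\equiv 0 \pmod k$, then $$G(\bar\chi)(cz+d)^{-s}H_1(Tz,s:\chi)=\bar\chi(b)\chi(c)G(\chi)2^{1-s}\chi(2)B_1(z,s:\bar\chi)$$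 $$+\bar\chi(b)\chi(c)\Big(-\frac{k}{2\pi i}\Big)^{s}e^{-\pi i s}\sum_{j=1}^{c}\sum_{\mu=0}^{k-1}\sum_{\nu=0}^{k-1}\bar\chi(\mu c+j)\Big\{\frac{\chi(2)}{2^{s-1}}\chi\Big(\Big[\frac{dj}{2c}\Big]-\nu\Big)f\Big(\frac z2,s,c,\frac d2\Big)-\chi\Big(\Big[\frac{dj}{c}\Big]-\nu\Big)f(z,s,c,d)\Big\}.$$ (ii) If $b\equiv c\equiv 0\pmod k$, then $$G(\bar\chi)(cz+d)^{-s}H_1(Tz,s:\chi)=\bar\chi(a)\chi(d)G(\bar\chi)2^{1-s}\bar\chi(2)B_1(z,s:\chi)$$ $$+\bar\chi(a)\chi(d)\Big(-\frac{k}{2\pi i}\Big)^{s}e^{-\pi i s}\sum_{j=1}^{c}\sum_{\mu=0}^{k-1}\sum_{\nu=0}^{k-1}\chi(j)\Big\{\bar\chi(2)\,2^{1-s}\,\bar\chi\Big(\Big[\frac{dj}{2c}\Big]+\frac d2\mu-\nu\Big)f\Big(\frac z2,s,c,\frac d2\Big)-\bar\chi\Big(\Big[\frac{dj}{c}\Big]+d\mu-\nu\Big)f(z,s,c,d)\Big\}.$$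 -/

import Mathlib

namespace CharTheta

noncomputable section

/-- The upper quarter-plane `{x + iy : x > -d/c, y > 0}`. -/
def quarterPlane (c d : ℤ) : Set ℂ := {z | -(d : ℝ) / (c : ℝ) < z.re ∧ 0 < z.im}

/-- `T z = (a z + b) / (c z + d)`. -/
def moebius (a b c d : ℤ) (z : ℂ) : ℂ := ((a : ℂ) * z + b) / ((c : ℂ) * z + d)

/-- The Gauss sum `G(χ) = ∑_{v mod k} χ(v) e^{2π i v / k}`. -/
def gauss {k : ℕ} [NeZero k] (χ : DirichletCharacter ℂ k) : ℂ := gaussSum χ ZMod.stdAddChar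

/-- The `(n, m)` term of the series `A₁(z, s : χ)`. -/
def A₁Term {k : ℕ} (χ : DirichletCharacter ℂ k) (s z : ℂ) (n m : ℕ+) : ℂ :=
  χ ((n : ℕ) : ZMod k) * χ ((m : ℕ) : ZMod k) * (-1 : ℂ) ^ (m : ℕ) * ((n : ℕ) : ℂ) ^ (s - 1) *
    Complex.exp (2 * Real.pi * Complex.I * ((m : ℕ) : ℂ) * ((n : ℕ) : ℂ) * z / k)

/-- `A₁(z, s : χ) = ∑_{n ≥ 1} ∑_{m ≥ 1} χ(n) χ(m) (-1)^m n^{s-1} e^{2π i m n z / k}`. -/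
def A₁ {k : ℕ} (z s : ℂ) (χ : DirichletCharacter ℂ k) : ℂ :=
  ∑' n : ℕ+, ∑' m : ℕ+, A₁Term χ s z n m

/-- `H₁(z, s : χ) = (1 + e^{π i s}) A₁(z, s : χ)`. -/
def H₁ {k : ℕ} (z s : ℂ) (χ : DirichletCharacter ℂ k) : ℂ :=
  (1 + Complex.exp (Real.pi * Complex.I * s)) * A₁ z s χ

/-- The `(n, m)` term of the series `B(z, s : χ)`. -/
def BTerm {k : ℕ} (χ : DirichletCharacter ℂ k) (s z : ℂ) (n : ℕ) (m : ℕ+) : ℂ :=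
  χ ((m : ℕ) : ZMod k) * χ ((2 * n + 1 : ℕ) : ZMod k) * ((2 * n + 1 : ℕ) : ℂ) ^ (s - 1) *
    Complex.exp (Real.pi * Complex.I * ((m : ℕ) : ℂ) * ((2 * n + 1 : ℕ) : ℂ) * z / k)

/-- `B(z, s : χ) = ∑_{n ≥ 0} ∑_{m ≥ 1} χ(m) χ(2n+1) (2n+1)^{s-1} e^{π i m (2n+1) z / k}`. -/
def B {k : ℕ} (z s : ℂ) (χ : DirichletCharacter ℂ k) : ℂ :=
  ∑' n : ℕ, ∑' m : ℕ+, BTerm χ s z n m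

/-- `B₁(z, s : χ) = (1 + e^{π i s}) B(z, s : χ)`. -/
def B₁ {k : ℕ} (z s : ℂ) (χ : DirichletCharacter ℂ k) : ℂ :=
  (1 + Complex.exp (Real.pi * Complex.I * s)) * B z s χ

/-- The branch of `log u` with `0 < arg u < 2π`, for `u` off the half-line `[0, ∞)`. -/
def branchLog (u : ℂ) : ℂ := Complex.log (-u) + Real.pi * Complex.I

theorem exp_branchLog {u : ℂ} (hu : u ≠ 0) : Complex.exp (branchLog u) = u := by
  rw [branchLog, Complex.exp_add, Complex.exp_log (neg_ne_zero.mpr hu), Complex.exp_pi_mul_I]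
  ring

theorem branchLog_im {u : ℂ} (hu : u.re < 0 ∨ u.im ≠ 0) :
    0 < (branchLog u).im ∧ (branchLog u).im < 2 * Real.pi := by
  have h1 : (branchLog u).im = Complex.arg (-u) + Real.pi := by
    simp [branchLog, Complex.log_im]
  have h2 := Complex.neg_pi_lt_arg (-u)
  have h3 : Complex.arg (-u) < Real.pi := by
    rw [Complex.arg_lt_pi_iff]
    rcases hu with h | h
    · left; simpa using h.le
    · right; simpa using h
  rw [h1]
  constructor <;> linarith

/-- `∫_C g(u) du` over the loop `C` that comes in from `+∞` along `Im u = δ`, `Re u ≥ 0`, goes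
around the origin in the positive direction on the left half of the circle `|u| = δ`, and returns
to `+∞` along `Im u = -δ`, `Re u ≥ 0`. -/
def loopIntegral (δ : ℝ) (g : ℂ → ℂ) : ℂ :=
  -(∫ t in Set.Ioi (0 : ℝ), g (t + δ * Complex.I))
    + (∫ θ in (Real.pi / 2)..(3 * Real.pi / 2),
        g (δ * Complex.exp (θ * Complex.I)) * (Complex.I * (δ * Complex.exp (θ * Complex.I))))
    + ∫ t in Set.Ioi (0 : ℝ), g (t - δ * Complex.I)

/-- Absolute convergence of the three integrals that make up `loopIntegral δ g`. -/
def LoopIntegrable (δ : ℝ) (g : ℂ → ℂ) : Prop :=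
  MeasureTheory.IntegrableOn (fun t : ℝ => g (t + δ * Complex.I)) (Set.Ioi 0) ∧
  IntervalIntegrable (fun θ : ℝ => g (δ * Complex.exp (θ * Complex.I)) *
    (Complex.I * (δ * Complex.exp (θ * Complex.I)))) MeasureTheory.volume
    (Real.pi / 2) (3 * Real.pi / 2) ∧
  MeasureTheory.IntegrableOn (fun t : ℝ => g (t - δ * Complex.I)) (Set.Ioi 0)

/-- The closed region bounded by the loop of `loopIntegral δ`. -/
def loopRegion (δ : ℝ) : Set ℂ := {u | ‖u‖ ≤ δ ∨ (0 ≤ u.re ∧ |u.im| ≤ δ)}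

/-- `u = 0` is the only zero of `(e^{-w k u} - 1) (e^{k u} - 1)` on or inside the loop of
`loopIntegral δ`. -/
def IsLoopWidth (k : ℕ) (w : ℂ) (δ : ℝ) : Prop :=
  0 < δ ∧ ∀ u ∈ loopRegion δ,
    (Complex.exp (-w * k * u) - 1) * (Complex.exp (k * u) - 1) = 0 → u = 0

/-- Every sufficiently small `δ` is admissible. -/
theorem exists_isLoopWidth {k : ℕ} (hk : 0 < k) {w : ℂ} (hw : 0 < w.re) :
    ∃ δ₀ > 0, ∀ δ, 0 < δ → δ < δ₀ → IsLoopWidth k w δ := by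
  have hk' : (0 : ℝ) < k := by exact_mod_cast hk
  have hkc : (k : ℂ) ≠ 0 := by exact_mod_cast hk.ne'
  have hw0 : w ≠ 0 := by rintro rfl; simp at hw
  have hN : 0 < Complex.normSq w := Complex.normSq_pos.mpr hw0
  have hpi := Real.pi_pos
  refine ⟨min (2 * Real.pi / k) (2 * Real.pi * w.re / (k * Complex.normSq w)),
    lt_min (by positivity) (by positivity), ?_⟩
  intro δ hδ hlt
  obtain ⟨h1, h2⟩ := lt_min_iff.mp hlt
  rw [lt_div_iff₀ hk'] at h1
  rw [lt_div_iff₀ (by positivity)] at h2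
  refine ⟨hδ, fun u hu h0 => ?_⟩
  have him : |u.im| ≤ δ := by
    rcases hu with h | h
    · exact (Complex.abs_im_le_norm u).trans h
    · exact h.2
  have small : ∀ n : ℤ, |(n : ℝ)| * (2 * Real.pi) < 2 * Real.pi → n = 0 := by
    intro n hn
    have : |(n : ℝ)| < 1 := by nlinarith
    have h' : |n| < 1 := by exact_mod_cast this
    exact Int.abs_lt_one_iff.mp h'
  rcases mul_eq_zero.mp h0 with h | h
  · obtain ⟨n, hn⟩ := Complex.exp_eq_one_iff.mp (sub_eq_zero.mp h)
    have hre := congrArg Complex.re hn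
    have himn := congrArg Complex.im hn
    simp at hre himn
    have key : (k : ℝ) * (Complex.normSq w * u.im) = -(n * (2 * Real.pi)) * w.re := by
      rw [Complex.normSq_apply]
      linear_combination (-w.re) * himn + w.im * hre
    have hn0 : n = 0 := by
      apply small
      have h3 := congrArg abs key
      rw [abs_mul, abs_mul, abs_mul, abs_neg, abs_mul, abs_of_pos hk', abs_of_pos hN,
        abs_of_pos hw, abs_of_pos (by positivity : (0 : ℝ) < 2 * Real.pi)] at h3
      have h4 : (k : ℝ) * (Complex.normSq w * |u.im|) ≤ δ * (k * Complex.normSq w) := by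
        have := mul_le_mul_of_nonneg_left him (by positivity : 0 ≤ (k : ℝ) * Complex.normSq w)
        nlinarith
      have h5 : |(n : ℝ)| * (2 * Real.pi) * w.re < 2 * Real.pi * w.re := by linarith
      exact lt_of_mul_lt_mul_right h5 hw.le
    subst hn0
    simpa [hkc, hw0] using hn
  · obtain ⟨n, hn⟩ := Complex.exp_eq_one_iff.mp (sub_eq_zero.mp h)
    have himn := congrArg Complex.im hn
    simp at himn
    have hn0 : n = 0 := by
      apply small
      have h3 := congrArg abs himn
      rw [abs_mul, abs_mul, abs_of_pos hk',
        abs_of_pos (by positivity : (0 : ℝ) < 2 * Real.pi)] at h3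
      nlinarith
    subst hn0
    simpa [hkc] using hn

/-- The integrand of `f(z, s, c, d)`; the power `u^{s-1}` is taken on the branch
`0 < arg u < 2π`. -/
def fIntegrand (k : ℕ) (z s : ℂ) (c d j : ℤ) (μ ν : ℕ) (u : ℂ) : ℂ :=
  Complex.exp (-((μ : ℂ) * c + j) * ((c : ℂ) * z + d) * u / c)
      / (Complex.exp (-((c : ℂ) * z + d) * k * u) - 1)
    * (Complex.exp (((ν : ℂ) + (Int.fract ((d : ℝ) * j / c) : ℝ)) * u)
      / (Complex.exp (k * u) - 1))
    * Complex.exp ((s - 1) * branchLog u)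

/-- `f(z, s, c, d)`, with its dependence on `k`, `j`, `μ`, `ν` and on the loop made explicit. -/
def f (k : ℕ) (δ : ℝ) (z s : ℂ) (c d j : ℤ) (μ ν : ℕ) : ℂ :=
  loopIntegral δ (fIntegrand k z s c d j μ ν)

end

end CharTheta

namespace CharTheta

open Complex MeasureTheory Set Filter Topology

/-! Everything reduces to the series A(z, s : χ) = ∑ χ(n)χ(m) n^{s-1} e^{2πimnz/k}. Separating
parities gives A₁(z) = 2χ(2)A(2z) - A(z) and B(z) = A(z/2) - χ(2)2^{s-1}A(z) (`A₁_eq`, `B_eq`). As d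
is even, 2Tz is the image of z/2 under the matrix (2a, b; c, d/2), again of determinant one. So the
theorem is 2^{1-s}χ(2) times the transformation law of A for that matrix, minus the law for T. The
powers of 2 match because ((cz+d)/2)^{-s} = 2^s (cz+d)^{-s}, and χ(2)χ̄(2) = 1 because k is odd.

The law for A (`A_transformation`) is proved for Re s > 3 and continued, both sides being entire in
s. Poisson summation and Gauss sums (`gauss_mul_A`) turn G(χ̄)A(z, s : χ) into a Gamma factor times
the sum of χ(M)χ̄(N)(Mz+N)^{-s} over the half-plane M > 0. The substitution T permutes the lattice
and carries this half-plane to another one. Points with M < 0 are reflected back, and there the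
principal powers produce e^{-πis}. What remains is (e^{-πis} - 1) times the sum over the cone M > 0,
cN > dM (`halfSum_moebius`). The congruences on a, b, c, d serve to make the character factor a
constant times ψ(M)ψ̄(N), with ψ = χ̄ or χ.

The cone splits into classes indexed by j, μ, ν (`range_coneMap`), and on each class Mz+N runs over
a translated quadrant p, q ≥ 0. Its sum is the Mellin transform of a product of two geometric
series, the meromorphic part of the integrand of `f`; collapsing the loop
(`IsLoopKernel.loopIntegral_eq`) supplies e^{2πis} - 1. The factor 1 + e^{πis} in H₁ and B₁ fits
because (1 + e^{πis})(e^{-πis} - 1) = -e^{-πis}(e^{2πis} - 1). -/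

/-! ### Holomorphy of parametric integrals. -/

/-- A parametric integral of functions that are holomorphic in the parameter and dominated near
`s₀` by an integrable function is complex differentiable at `s₀`. -/
theorem differentiableAt_integral_of_dominated {X : Type*} [MeasurableSpace X] {μ : Measure X}
    {F : ℂ → X → ℂ} {bound : X → ℝ} {s₀ : ℂ} {r : ℝ} (hr : 0 < r)
    (hmeas : ∀ s ∈ Metric.ball s₀ r, AEStronglyMeasurable (F s) μ)
    (hdiff : ∀ᵐ x ∂μ, DifferentiableOn ℂ (fun s => F s x) (Metric.ball s₀ r))
    (hbound : ∀ᵐ x ∂μ, ∀ s ∈ Metric.ball s₀ r, ‖F s x‖ ≤ bound x)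
    (hint : Integrable bound μ) :
    DifferentiableAt ℂ (fun s => ∫ x, F s x ∂μ) s₀ := by
  have hsub : Metric.ball s₀ (r / 2) ⊆ Metric.ball s₀ r := Metric.ball_subset_ball (by linarith)
  have hs₀ : s₀ ∈ Metric.ball s₀ r := Metric.mem_ball_self hr
  have hder : ∀ᵐ x ∂μ, ∀ s ∈ Metric.ball s₀ r,
      HasDerivAt (fun s => F s x) (deriv (fun s => F s x) s) s := by
    filter_upwards [hdiff] with x hx s hs
    exact (hx.differentiableAt (Metric.isOpen_ball.mem_nhds hs)).hasDerivAt
  refine (hasDerivAt_integral_of_dominated_loc_of_deriv_le (μ := μ) (F := F)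
    (F' := fun s x => deriv (fun s => F s x) s) (bound := fun x => bound x / (r / 4))
    (Metric.ball_mem_nhds s₀ (half_pos hr)) ?_ ?_ ?_ ?_ ?_ ?_).2.differentiableAt
  · filter_upwards [Metric.ball_mem_nhds s₀ hr] with s hs using hmeas s hs
  · exact hint.mono' (hmeas s₀ hs₀) (by filter_upwards [hbound] with x hx using hx s₀ hs₀)
  -- Measurability in x of the derivative at s₀: it is an a.e. limit of difference quotients along a
  -- sequence inside the ball.
  · have hu : Tendsto (fun n : ℕ => s₀ + ((r / 2 : ℝ) : ℂ) * (1 / ((n : ℂ) + 1))) atTop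
        (𝓝[≠] s₀) := by
      refine tendsto_nhdsWithin_iff.mpr ⟨?_, Eventually.of_forall fun n => ?_⟩
      · have := (tendsto_one_div_add_atTop_nhds_zero_nat (𝕜 := ℂ)).const_mul ((r / 2 : ℝ) : ℂ)
        simpa using this.const_add s₀
      · have : ((n : ℂ) + 1) ≠ 0 := by exact_mod_cast Nat.succ_ne_zero n
        simp [this, hr.ne']
    refine aestronglyMeasurable_of_tendsto_ae (u := atTop)
      (f := fun n : ℕ => fun x => slope (fun s => F s x) s₀
        (s₀ + ((r / 2 : ℝ) : ℂ) * (1 / ((n : ℂ) + 1)))) (fun n => ?_) ?_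
    · simp only [slope_def_field, div_eq_mul_inv (_ - _)]
      refine AEStronglyMeasurable.mul_const (AEStronglyMeasurable.sub (hmeas _ ?_) (hmeas _ hs₀)) _
      have hn : ‖(n : ℂ) + 1‖ = (n : ℝ) + 1 := by
        exact_mod_cast Complex.norm_natCast (n + 1)
      rw [Metric.mem_ball, dist_eq_norm, add_sub_cancel_left, norm_mul, norm_div, hn,
        Complex.norm_real, Real.norm_of_nonneg (by positivity), norm_one]
      have : 1 / ((n : ℝ) + 1) ≤ 1 := by
        rw [div_le_one (by positivity)]; linarith [Nat.cast_nonneg (α := ℝ) n]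
      nlinarith
    · filter_upwards [hder] with x hx
      exact (hasDerivAt_iff_tendsto_slope.mp (hx s₀ hs₀)).comp hu
  -- Cauchy's estimate on circles of radius r/4, which stay in the large ball when the centre is
  -- within r/2 of s₀.
  · filter_upwards [hbound, hdiff] with x hx hd s hs
    have hball : Metric.closedBall s (r / 4) ⊆ Metric.ball s₀ r := by
      intro t ht
      rw [Metric.mem_closedBall] at ht
      rw [Metric.mem_ball] at hs ⊢
      linarith [dist_triangle t s s₀]
    refine norm_deriv_le_of_forall_mem_sphere_norm_le (by positivity) ?_ ?_
    · refine DifferentiableOn.diffContOnCl_ball (U := Metric.ball s₀ r) hd hball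
    · intro t ht
      exact hx t (hball (Metric.sphere_subset_closedBall ht))
  · exact hint.div_const _
  · filter_upwards [hder] with x hx s hs using hx s (hsub hs)

/-! ### The Gamma integral with complex rate. -/

theorem measurable_cpow_mul_exp (s r : ℂ) :
    Measurable (fun t : ℝ => (t : ℂ) ^ (s - 1) * exp (-(r * t))) := by
  fun_prop

theorem norm_cpow_mul_exp {s r : ℂ} {t : ℝ} (ht : 0 < t) :
    ‖(t : ℂ) ^ (s - 1) * exp (-(r * t))‖ = t ^ (s.re - 1) * Real.exp (-(r.re * t)) := by
  rw [norm_mul, norm_cpow_eq_rpow_re_of_pos ht, norm_exp]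
  simp

theorem integrableOn_rpow_mul_exp {σ ρ : ℝ} (hσ : 0 < σ) (hρ : 0 < ρ) :
    IntegrableOn (fun t : ℝ => t ^ (σ - 1) * Real.exp (-(ρ * t))) (Ioi 0) := by
  have := integrableOn_rpow_mul_exp_neg_mul_rpow (p := 1) (s := σ - 1) (by linarith) one_pos hρ
  simpa using this

theorem integrableOn_cpow_mul_exp {s r : ℂ} (hs : 0 < s.re) (hr : 0 < r.re) :
    IntegrableOn (fun t : ℝ => (t : ℂ) ^ (s - 1) * exp (-(r * t))) (Ioi 0) := by
  refine (integrableOn_rpow_mul_exp hs hr).mono' (measurable_cpow_mul_exp s r).aestronglyMeasurable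
    ?_
  filter_upwards [ae_restrict_mem measurableSet_Ioi] with t ht
  exact (norm_cpow_mul_exp ht).le

theorem one_div_cpow_eq_cpow_neg {r : ℂ} (hr : 0 < r.re) (s : ℂ) : (1 / r) ^ s = r ^ (-s) := by
  rw [one_div, inv_cpow, cpow_neg]
  intro h
  rw [arg_eq_pi_iff] at h
  linarith [h.1]

/-- `∫₀^∞ t^{s-1} e^{-rt} dt = r^{-s} Γ(s)` for complex `r` with positive real part. -/
theorem integral_cpow_mul_exp_Ioi {s r : ℂ} (hs : 0 < s.re) (hr : 0 < r.re) :
    ∫ t in Ioi (0 : ℝ), (t : ℂ) ^ (s - 1) * exp (-(r * t)) = r ^ (-s) * Gamma s := by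
  have hopen : IsOpen {r : ℂ | 0 < r.re} := isOpen_lt continuous_const continuous_re
  have hpre : IsPreconnected {r : ℂ | 0 < r.re} := (convex_halfSpace_re_gt 0).isPreconnected
  have hF : AnalyticOnNhd ℂ (fun r : ℂ => ∫ t in Ioi (0 : ℝ), (t : ℂ) ^ (s - 1) * exp (-(r * t)))
      {r : ℂ | 0 < r.re} := by
    refine DifferentiableOn.analyticOnNhd (fun r₀ hr₀ => ?_) hopen
    rw [mem_ofPred_eq] at hr₀
    refine (differentiableAt_integral_of_dominated (r := r₀.re / 2)
      (bound := fun t => t ^ (s.re - 1) * Real.exp (-(r₀.re / 2 * t))) (half_pos hr₀)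
      (fun r _ => (measurable_cpow_mul_exp s r).aestronglyMeasurable) ?_ ?_
      (integrableOn_rpow_mul_exp hs (half_pos hr₀))).differentiableWithinAt
    · filter_upwards with t
      fun_prop
    · filter_upwards [ae_restrict_mem measurableSet_Ioi] with t ht r hr
      rw [norm_cpow_mul_exp ht]
      have h1 : |(r - r₀).re| < r₀.re / 2 := by
        refine (abs_re_le_norm _).trans_lt ?_
        rwa [Metric.mem_ball, dist_eq_norm] at hr
      rw [sub_re] at h1
      have h2 := (abs_lt.mp h1).1
      have ht' : (0 : ℝ) < t := ht
      gcongr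
      linarith
  have hG : AnalyticOnNhd ℂ (fun r : ℂ => r ^ (-s) * Gamma s) {r : ℂ | 0 < r.re} := by
    refine DifferentiableOn.analyticOnNhd (fun r₀ hr₀ => ?_) hopen
    refine ((differentiableAt_id.cpow_const ?_).mul_const _).differentiableWithinAt
    exact Or.inl hr₀
  have hreal : ∀ ρ : ℝ, 0 < ρ → ∫ t in Ioi (0 : ℝ), (t : ℂ) ^ (s - 1) * exp (-((ρ : ℂ) * t))
      = (ρ : ℂ) ^ (-s) * Gamma s := by
    intro ρ hρ
    rw [integral_cpow_mul_exp_neg_mul_Ioi hs hρ, one_div_cpow_eq_cpow_neg (by simpa using hρ)]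
  have hu : Tendsto (fun n : ℕ => (1 : ℂ) + 1 / ((n : ℂ) + 1)) atTop (𝓝[≠] 1) := by
    refine tendsto_nhdsWithin_iff.mpr ⟨?_, Eventually.of_forall fun n => ?_⟩
    · simpa using (tendsto_one_div_add_atTop_nhds_zero_nat (𝕜 := ℂ)).const_add 1
    · have : ((n : ℂ) + 1) ≠ 0 := by exact_mod_cast Nat.succ_ne_zero n
      simp [this]
  -- Identity theorem in r: the integral is known at the real points 1 + 1/(n+1), which accumulate
  -- at 1.
  refine hF.eqOn_of_preconnected_of_frequently_eq hG hpre (z₀ := 1) (by simp) ?_ hr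
  refine hu.frequently (Eventually.of_forall fun n => ?_).frequently
  have := hreal (1 + 1 / ((n : ℝ) + 1)) (by positivity)
  push_cast at this
  exact this

/-! ### Principal powers and convergence of lattice sums. -/

theorem mul_cpow_of_arg {x y : ℂ} (hx : x ≠ 0) (hy : y ≠ 0)
    (h : arg x + arg y ∈ Ioc (-Real.pi) Real.pi) (s : ℂ) : (x * y) ^ s = x ^ s * y ^ s := by
  rw [cpow_def_of_ne_zero (mul_ne_zero hx hy), cpow_def_of_ne_zero hx, cpow_def_of_ne_zero hy,
    (log_mul_eq_add_log_iff hx hy).mpr h, ← Complex.exp_add]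
  ring_nf

theorem arg_mem_Ioo_of_im_pos {x : ℂ} (hx : 0 < x.im) : arg x ∈ Ioo 0 Real.pi := by
  refine ⟨lt_of_le_of_ne (arg_nonneg_iff.mpr hx.le) fun h => ?_, arg_lt_pi_iff.mpr (Or.inr hx.ne')⟩
  exact hx.ne' (arg_eq_zero_iff.mp h.symm).2

theorem norm_cpow_neg_le (x s : ℂ) :
    ‖x ^ (-s)‖ ≤ ‖x‖ ^ (-s.re) * Real.exp (Real.pi * |s.im|) := by
  refine (norm_cpow_le x (-s)).trans ?_
  rw [neg_re, div_eq_mul_inv, ← Real.exp_neg]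
  gcongr
  rw [neg_im]
  have h1 := abs_arg_le_pi x
  calc -(arg x * -s.im) = arg x * s.im := by ring
    _ ≤ |arg x * s.im| := le_abs_self _
    _ = |arg x| * |s.im| := abs_mul _ _
    _ ≤ _ := by gcongr

/-- The argument contributes at most e^{π|Im s|} to the norm; the rest is the Eisenstein lower bound
for |Mz+N| by a multiple of max(|M|, |N|). -/
theorem summable_lattice {z s : ℂ} (hz : 0 < z.im) (hs : 2 < s.re) :
    Summable (fun p : ℤ × ℤ => ‖((p.1 : ℂ) * z + p.2) ^ (-s)‖) := by
  have h := (EisensteinSeries.summable_one_div_norm_rpow hs).comp_injective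
    (finTwoArrowEquiv ℤ).symm.injective
  refine Summable.of_nonneg_of_le (fun _ => norm_nonneg _) (fun p => ?_)
    (h.mul_left (EisensteinSeries.r ⟨z, hz⟩ ^ (-s.re) * Real.exp (Real.pi * |s.im|)))
  refine (norm_cpow_neg_le _ s).trans ?_
  have h2 := EisensteinSeries.summand_bound ⟨z, hz⟩ (by linarith : 0 ≤ s.re)
    ((finTwoArrowEquiv ℤ).symm p)
  simp only [finTwoArrowEquiv_symm_apply, Matrix.cons_val_zero, Matrix.cons_val_one,
    Function.comp] at h2 ⊢
  calc _ ≤ _ := mul_le_mul_of_nonneg_right h2 (Real.exp_pos _).le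
    _ = _ := by ring

theorem summable_int_add_cpow {z s : ℂ} (hz : 0 < z.im) (hs : 2 < s.re) :
    Summable (fun n : ℤ => ‖(z + n) ^ (-s)‖) := by
  have h := (summable_lattice hz hs).comp_injective
    (i := fun n : ℤ => ((1 : ℤ), n)) (fun a b hab => (Prod.ext_iff.mp hab).2)
  simpa [Function.comp_def] using h

/-! ### Lipschitz summation by Poisson's formula. -/

/-- The function `x ↦ x^{s-1} e^{2π i τ x}` on `(0, ∞)`, extended by zero. -/
noncomputable def powExp (s τ : ℂ) (x : ℝ) : ℂ :=
  ((max x 0 : ℝ) : ℂ) ^ (s - 1) * exp (2 * Real.pi * I * τ * x)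

theorem powExp_of_nonpos {s τ : ℂ} (hs : 2 < s.re) {x : ℝ} (hx : x ≤ 0) : powExp s τ x = 0 := by
  have : s - 1 ≠ 0 := by
    intro h
    have := congrArg re h
    simp at this
    linarith
  simp [powExp, max_eq_right hx, zero_cpow this]

theorem powExp_of_pos (s τ : ℂ) {x : ℝ} (hx : 0 < x) :
    powExp s τ x = (x : ℂ) ^ (s - 1) * exp (2 * Real.pi * I * τ * x) := by
  rw [powExp, max_eq_left hx.le]

theorem continuous_powExp {s : ℂ} (τ : ℂ) (hs : 2 < s.re) : Continuous (powExp s τ) := by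
  have h1 : Continuous (fun x : ℝ => (x : ℂ) ^ (s - 1)) :=
    continuous_ofReal_cpow_const (by rw [sub_re, one_re]; linarith)
  have h2 : Continuous (fun x : ℝ => max x 0) := by fun_prop
  exact (h1.comp h2).mul (by fun_prop)

theorem norm_powExp {s τ : ℂ} {x : ℝ} (hx : 0 < x) :
    ‖powExp s τ x‖ = x ^ (s.re - 1) * Real.exp (-(2 * Real.pi * τ.im) * x) := by
  rw [powExp_of_pos _ _ hx, norm_mul, norm_cpow_eq_rpow_re_of_pos hx, norm_exp]
  congr 2
  simp

theorem powExp_isBigO {s τ : ℂ} (hs : 2 < s.re) (hτ : 0 < τ.im) :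
    powExp s τ =O[cocompact ℝ] fun x : ℝ => |x| ^ (-2 : ℝ) := by
  rw [cocompact_eq_atBot_atTop, Asymptotics.isBigO_sup]
  constructor
  · refine Asymptotics.IsBigO.of_bound 1 ?_
    filter_upwards [eventually_le_atBot 0] with x hx
    rw [powExp_of_nonpos hs hx, norm_zero]
    positivity
  -- The exponent -Re s - 1 is chosen so that the product with x^{Re s - 1} is x^{-2}, enough decay
  -- for Poisson summation.
  · have h1 := (isLittleO_exp_neg_mul_rpow_atTop (a := 2 * Real.pi * τ.im) (by positivity)
      (-s.re - 1)).isBigO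
    have h2 := (Asymptotics.isBigO_refl (fun x : ℝ => x ^ (s.re - 1)) atTop).mul h1
    rw [← Asymptotics.isBigO_norm_left]
    refine h2.congr' ?_ ?_
    · filter_upwards [eventually_gt_atTop 0] with x hx
      rw [norm_powExp hx]
    · filter_upwards [eventually_gt_atTop 0] with x hx
      rw [← Real.rpow_add hx, abs_of_pos hx]
      congr 1
      ring

/-- The arguments -π/2 and arg τ ∈ (0, π) add up to less than π in absolute value, so no branch
correction arises. -/
theorem neg_two_pi_I_mul_cpow {τ : ℂ} (hτ : 0 < τ.im) (s : ℂ) :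
    (-(2 * Real.pi * I) * τ) ^ s = (-(2 * Real.pi * I)) ^ s * τ ^ s := by
  have h0 : τ ≠ 0 := by rintro rfl; simp at hτ
  have hp := Real.pi_pos
  have e : -(2 * Real.pi * I : ℂ) = ((2 * Real.pi : ℝ) : ℂ) * -I := by push_cast; ring
  have ha : arg (-(2 * Real.pi * I : ℂ)) = -(Real.pi / 2) := by
    rw [e, arg_real_mul _ (by positivity), arg_neg_I]
  have h := arg_mem_Ioo_of_im_pos hτ
  refine mul_cpow_of_arg (by simp [Real.pi_ne_zero]) h0 ?_ s
  rw [ha]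
  constructor <;> linarith [h.1, h.2]

/-- The transform is the Gamma integral with rate -2πi(τ - n), whose real part is 2π Im τ > 0. -/
theorem fourier_powExp {s τ : ℂ} (hs : 2 < s.re) (hτ : 0 < τ.im) (n : ℤ) :
    FourierTransform.fourier (powExp s τ) (n : ℝ) =
      (-(2 * Real.pi * I)) ^ (-s) * Gamma s * (τ - n) ^ (-s) := by
  have him : 0 < (τ - n).im := by simpa using hτ
  have hre : 0 < (-(2 * Real.pi * I) * (τ - n)).re := by
    have : (-(2 * Real.pi * I) * (τ - n)).re = 2 * Real.pi * τ.im := by simp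
    rw [this]; have := Real.pi_pos; positivity
  rw [Real.fourier_real_eq_integral_exp_smul,
    ← setIntegral_eq_integral_of_forall_compl_eq_zero (s := Ioi (0 : ℝ)),
    mul_right_comm, ← neg_two_pi_I_mul_cpow him, ← integral_cpow_mul_exp_Ioi (by linarith) hre]
  · refine setIntegral_congr_fun measurableSet_Ioi fun x hx => ?_
    rw [powExp_of_pos _ _ hx, smul_eq_mul, mul_left_comm, ← Complex.exp_add]
    congr 2
    push_cast
    ring
  · intro x hx
    rw [powExp_of_nonpos hs (by simpa using hx), smul_zero]

theorem tsum_int_eq_tsum_pnat {f : ℤ → ℂ} (h : ∀ n ≤ 0, f n = 0) :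
    ∑' n : ℤ, f n = ∑' n : ℕ+, f ((n : ℕ) : ℤ) := by
  have hinj : Function.Injective (fun n : ℕ+ => ((n : ℕ) : ℤ)) := fun a b hab => by
    simpa using hab
  refine (hinj.tsum_eq fun n hn => ?_).symm
  have hn0 : 0 < n := by
    by_contra hle
    exact hn (h n (not_lt.mp hle))
  exact ⟨⟨n.toNat, by omega⟩, by simp [hn0.le]⟩

/-- **Lipschitz summation formula**. -/
theorem tsum_cpow_mul_exp_eq {s τ : ℂ} (hs : 2 < s.re) (hτ : 0 < τ.im) :
    ∑' l : ℕ+, ((l : ℕ) : ℂ) ^ (s - 1) * exp (2 * Real.pi * I * τ * (l : ℕ)) =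
      (-(2 * Real.pi * I)) ^ (-s) * Gamma s * ∑' n : ℤ, (τ + n) ^ (-s) := by
  have hsum : Summable fun n : ℤ => FourierTransform.fourier (powExp s τ) (n : ℝ) := by
    simp only [fourier_powExp hs hτ]
    refine Summable.mul_left _ ?_
    have := (summable_int_add_cpow hτ hs).of_norm.comp_injective neg_injective
    simpa [Function.comp_def, ← sub_eq_add_neg] using this
  have h := Real.tsum_eq_tsum_fourier_of_rpow_decay_of_summable (continuous_powExp τ hs) one_lt_two
    (powExp_isBigO hs hτ) hsum 0
  simp only [zero_add, fourier_powExp hs hτ, QuotientAddGroup.mk_zero, fourier_eval_zero,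
    mul_one, tsum_mul_left] at h
  rw [tsum_int_eq_tsum_pnat fun n hn => powExp_of_nonpos hs (by exact_mod_cast hn)] at h
  rw [← (Equiv.neg ℤ).tsum_eq] at h
  simp only [Equiv.neg_apply, Int.cast_neg, sub_neg_eq_add] at h
  rw [← h]
  refine tsum_congr fun l => ?_
  rw [powExp_of_pos _ _ (by simp)]
  simp

/-! ### The series A: convergence and holomorphy in s. -/

/-- The `(n, m)` term of the series `∑ χ(n) χ(m) n^{s-1} e^{2π i m n z / k}`. -/
noncomputable def ATerm {k : ℕ} (χ : DirichletCharacter ℂ k) (s z : ℂ) (p : ℕ+ × ℕ+) : ℂ :=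
  χ ((p.1 : ℕ) : ZMod k) * χ ((p.2 : ℕ) : ZMod k) * ((p.1 : ℕ) : ℂ) ^ (s - 1) *
    exp (2 * Real.pi * I * ((p.2 : ℕ) : ℂ) * ((p.1 : ℕ) : ℂ) * z / k)

/-- The series `∑ χ(n) χ(m) n^{s-1} e^{2π i m n z / k}`. -/
noncomputable def A {k : ℕ} (z s : ℂ) (χ : DirichletCharacter ℂ k) : ℂ := ∑' p, ATerm χ s z p

theorem norm_exp_ATerm (k : ℕ) (z : ℂ) (p : ℕ+ × ℕ+) :
    ‖exp (2 * Real.pi * I * ((p.2 : ℕ) : ℂ) * ((p.1 : ℕ) : ℂ) * z / k)‖ =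
      Real.exp (-(2 * Real.pi * z.im / k)) ^ ((p.1 : ℕ) * p.2) := by
  rw [norm_exp, ← Real.exp_nat_mul]
  congr 1
  rw [show (2 * Real.pi * I * ((p.2 : ℕ) : ℂ) * ((p.1 : ℕ) : ℂ) * z / k) =
    ((2 * Real.pi * (p.2 : ℕ) * (p.1 : ℕ) / k : ℝ) : ℂ) * (I * z) by push_cast; ring,
    re_ofReal_mul, I_mul_re]
  push_cast
  ring

section Series

variable {k : ℕ} [NeZero k] (χ : DirichletCharacter ℂ k)

/-- From (n-1)(m-1) ≥ 0 one gets ρ^{nm} ≤ ρ^{n+m-1}, a product of single terms. The bound is uniform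
for Re s ≤ R + 1, so it yields both absolute convergence and holomorphy in s. -/
theorem norm_ATerm_le {z s : ℂ} {R : ℕ} (hz : 0 < z.im) (hs : s.re - 1 ≤ R) (p : ℕ+ × ℕ+) :
    ‖ATerm χ s z p‖ ≤ ((p.1 : ℕ) : ℝ) ^ R * Real.exp (-(2 * Real.pi * z.im / k)) ^ (p.1 : ℕ) *
      (Real.exp (-(2 * Real.pi * z.im / k)) ^ (p.2 : ℕ) *
        (Real.exp (-(2 * Real.pi * z.im / k)))⁻¹) := by
  have hk : (0 : ℝ) < k := by exact_mod_cast NeZero.pos k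
  rw [ATerm, norm_mul, norm_exp_ATerm k]
  set ρ := Real.exp (-(2 * Real.pi * z.im / k)) with hρ
  have hρ0 : 0 < ρ := Real.exp_pos _
  have hρ1 : ρ < 1 := by
    have := Real.pi_pos
    rw [hρ, Real.exp_lt_one_iff, neg_lt_zero]; positivity
  rw [norm_mul, norm_mul, norm_natCast_cpow_of_pos p.1.pos]
  have h1 : ((p.1 : ℕ) : ℝ) ^ (s - 1).re ≤ ((p.1 : ℕ) : ℝ) ^ R := by
    rw [← Real.rpow_natCast]
    exact Real.rpow_le_rpow_of_exponent_le (by exact_mod_cast p.1.pos) (by simpa using hs)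
  have h2 : ρ ^ ((p.1 : ℕ) * p.2) ≤ ρ ^ (p.1 : ℕ) * (ρ ^ (p.2 : ℕ) * ρ⁻¹) := by
    have h3 : (p.1 : ℕ) + p.2 ≤ (p.1 : ℕ) * p.2 + 1 := by nlinarith [p.1.pos, p.2.pos]
    rw [← mul_assoc, ← pow_add, le_mul_inv_iff₀ hρ0, ← pow_succ]
    exact pow_le_pow_of_le_one hρ0.le hρ1.le h3
  calc _ ≤ 1 * 1 * ((p.1 : ℕ) : ℝ) ^ R * (ρ ^ (p.1 : ℕ) * (ρ ^ (p.2 : ℕ) * ρ⁻¹)) := by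
        gcongr
        · exact χ.norm_le_one _
        · exact χ.norm_le_one _
    _ = _ := by ring

theorem summable_ATerm_bound {ρ : ℝ} (h0 : 0 < ρ) (h1 : ρ < 1) (R : ℕ) :
    Summable fun p : ℕ+ × ℕ+ => ((p.1 : ℕ) : ℝ) ^ R * ρ ^ (p.1 : ℕ) * (ρ ^ (p.2 : ℕ) * ρ⁻¹) := by
  have hρ : ‖ρ‖ < 1 := by rwa [Real.norm_of_nonneg h0.le]
  refine Summable.mul_of_nonneg (f := fun n : ℕ+ => ((n : ℕ) : ℝ) ^ R * ρ ^ (n : ℕ))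
    (g := fun n : ℕ+ => ρ ^ (n : ℕ) * ρ⁻¹) ?_ ?_ (fun _ => by positivity) (fun _ => by positivity)
  · exact (summable_pow_mul_geometric_of_norm_lt_one R hρ).comp_injective PNat.coe_injective
  · exact ((summable_geometric_of_norm_lt_one hρ).comp_injective PNat.coe_injective).mul_right _

theorem exp_neg_div_lt_one {z : ℂ} (hz : 0 < z.im) :
    Real.exp (-(2 * Real.pi * z.im / k)) < 1 := by
  have hk : (0 : ℝ) < k := by exact_mod_cast NeZero.pos k
  have := Real.pi_pos
  rw [Real.exp_lt_one_iff, neg_lt_zero]; positivity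

theorem summable_ATerm {z : ℂ} (s : ℂ) (hz : 0 < z.im) : Summable (ATerm χ s z) := by
  obtain ⟨R, hR⟩ := exists_nat_ge (s.re - 1)
  exact Summable.of_norm_bounded (summable_ATerm_bound (Real.exp_pos _) (exp_neg_div_lt_one hz) R)
    (norm_ATerm_le χ hz hR)

theorem differentiable_A {z : ℂ} (hz : 0 < z.im) : Differentiable ℂ (fun s => A z s χ) := by
  intro s₀
  obtain ⟨R, hR⟩ := exists_nat_ge s₀.re
  have hopen : IsOpen {s : ℂ | s.re < R + 1} := isOpen_lt continuous_re continuous_const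
  have hmem : s₀ ∈ {s : ℂ | s.re < R + 1} := by
    rw [mem_ofPred_eq]; linarith
  refine (differentiableOn_tsum_of_summable_norm
    (summable_ATerm_bound (Real.exp_pos _) (exp_neg_div_lt_one (k := k) hz) R)
    (fun p => ?_) hopen (fun p s hs => norm_ATerm_le χ hz ?_ p)).differentiableAt
      (hopen.mem_nhds hmem)
  · intro s _
    have hp : ((p.1 : ℕ) : ℂ) ≠ 0 := by exact_mod_cast p.1.ne_zero
    unfold ATerm
    refine DifferentiableAt.differentiableWithinAt ?_
    refine DifferentiableAt.mul_const (DifferentiableAt.const_mul ?_ _) _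
    exact (differentiableAt_id.sub_const 1).const_cpow (Or.inl hp)
  · rw [mem_ofPred_eq] at hs; linarith

end Series

/-! ### Gauss sums and the twisted Lipschitz formula. -/

theorem star_isPrimitive {k : ℕ} {χ : DirichletCharacter ℂ k} (h : χ.IsPrimitive) :
    (star χ).IsPrimitive := by
  rw [MulChar.star_eq_inv, DirichletCharacter.isPrimitive_def, DirichletCharacter.conductor_inv]
  exact h

theorem tsum_int_eq_sum_fin {k : ℕ} [NeZero k] {g : ℤ → ℂ} (hg : Summable g) :
    ∑' n : ℤ, g n = ∑ r : Fin k, ∑' q : ℤ, g (q * k + (r : ℕ)) := by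
  rw [← (Int.divModEquiv k).symm.tsum_eq, ← (Equiv.prodComm (Fin k) ℤ).tsum_eq]
  have h2 := ((Int.divModEquiv k).symm.summable_iff.mpr hg)
  rw [← (Equiv.prodComm (Fin k) ℤ).summable_iff] at h2
  exact (Summable.tsum_prod h2).trans (tsum_fintype _)

section Lipschitz

variable {k : ℕ} [NeZero k] {ψ : DirichletCharacter ℂ k}

theorem sum_zmod_eq_sum_fin (F : ZMod k → ℂ) : ∑ r, F r = ∑ r : Fin k, F ((r : ℕ) : ZMod k) := by
  refine (Fintype.sum_bijective (fun r : Fin k => ((r : ℕ) : ZMod k)) ?_ _ _ fun _ => rfl).symm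
  refine (Fintype.bijective_iff_injective_and_card _).mpr ⟨fun a b hab => ?_, by simp⟩
  have h := (ZMod.natCast_eq_natCast_iff' _ _ _).mp hab
  rw [Nat.mod_eq_of_lt a.isLt, Nat.mod_eq_of_lt b.isLt] at h
  exact Fin.ext h

/-- Separability of the Gauss sum; primitivity gives it for every l, including those not coprime to
k. -/
theorem gauss_star_mul (hψ : ψ.IsPrimitive) (l : ℕ) :
    gauss (star ψ) * ψ l = ∑ r : Fin k, star ψ ((r : ℕ) : ZMod k) *
      exp (2 * Real.pi * I * ((l : ℂ) * (r : ℕ) / k)) := by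
  have h := gaussSum_mulShift_of_isPrimitive (ZMod.stdAddChar (N := k)) (star_isPrimitive hψ) (l : ZMod k)
  rw [MulChar.star_eq_inv, inv_inv, ← MulChar.star_eq_inv] at h
  rw [gauss, mul_comm, ← h, gaussSum, sum_zmod_eq_sum_fin]
  refine Finset.sum_congr rfl fun r _ => ?_
  rw [AddChar.mulShift_apply]
  have := ZMod.stdAddChar_coe (N := k) ((l : ℤ) * (r : ℕ))
  push_cast at this
  rw [this]
  congr 2
  ring

/-- Here -2πi has argument -π/2 and -k/(2πi) = ik/(2π) has argument π/2, so the principal logarithms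
match without a multiple of 2πi. -/
theorem inv_two_pi_cpow (s : ℂ) :
    (-(2 * Real.pi * I)) ^ (-s) * (k : ℂ) ^ s = (-(k : ℂ) / (2 * Real.pi * I)) ^ s := by
  have hk : (0 : ℝ) < k := by exact_mod_cast NeZero.pos k
  have hp := Real.pi_pos
  have e1 : -(k : ℂ) / (2 * Real.pi * I) = ((k / (2 * Real.pi) : ℝ) : ℂ) * I := by
    have hp' : (Real.pi : ℂ) ≠ 0 := by exact_mod_cast hp.ne'
    push_cast
    field_simp
    rw [I_sq, mul_neg_one]
  have e2 : -(2 * Real.pi * I : ℂ) = ((2 * Real.pi : ℝ) : ℂ) * -I := by push_cast; ring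
  have hl1 : log (-(k : ℂ) / (2 * Real.pi * I)) = (Real.log k - Real.log (2 * Real.pi) : ℝ)
      + Real.pi / 2 * I := by
    rw [e1, log_ofReal_mul (by positivity) I_ne_zero, log_I, Real.log_div hk.ne' (by positivity)]
  have hl2 : log (-(2 * Real.pi * I : ℂ)) = (Real.log (2 * Real.pi) : ℝ) + -(Real.pi / 2) * I := by
    rw [e2, log_ofReal_mul (by positivity) (neg_ne_zero.mpr I_ne_zero), log_neg_I]
  have hk' : (k : ℂ) ≠ 0 := by exact_mod_cast hk.ne'
  have hp' : (Real.pi : ℂ) ≠ 0 := by exact_mod_cast hp.ne'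
  rw [cpow_def_of_ne_zero (by simp [hp']), cpow_def_of_ne_zero hk',
    cpow_def_of_ne_zero (by simp [hp', hk']), hl1, hl2, ← Complex.exp_add,
    show log (k : ℂ) = (Real.log k : ℝ) by rw [ofReal_log hk.le]; simp]
  congr 1
  push_cast
  ring

theorem div_natCast_cpow_neg (x s : ℂ) :
    (x / k) ^ (-s) = (k : ℂ) ^ s * x ^ (-s) := by
  have hk : (0 : ℝ) < k := by exact_mod_cast NeZero.pos k
  rcases eq_or_ne x 0 with rfl | hx
  · rcases eq_or_ne s 0 with rfl | hs
    · simp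
    · simp [zero_cpow (neg_ne_zero.mpr hs)]
  have hk' : (k : ℂ) ≠ 0 := by exact_mod_cast hk.ne'
  have hl : log (x / k) = log x - Real.log k := by
    rw [div_eq_inv_mul, show ((k : ℂ)⁻¹) = (((k : ℝ)⁻¹ : ℝ) : ℂ) by push_cast; rfl,
      log_ofReal_mul (by positivity) hx, Real.log_inv]
    push_cast; ring
  rw [cpow_def_of_ne_zero (div_ne_zero hx hk'), cpow_def_of_ne_zero hk', cpow_def_of_ne_zero hx,
    hl, ← Complex.exp_add, show log (k : ℂ) = (Real.log k : ℝ) by rw [ofReal_log hk.le]; simp]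
  ring_nf

theorem summable_pnat_cpow_mul_exp {s τ : ℂ} (hτ : 0 < τ.im) :
    Summable fun l : ℕ+ => ((l : ℕ) : ℂ) ^ (s - 1) * exp (2 * Real.pi * I * τ * (l : ℕ)) := by
  -- This series is the row m = 1 of the series A for the character modulo 1.
  have h := (summable_ATerm (k := 1) 1 s hτ).comp_injective
    (i := fun n : ℕ+ => (n, (1 : ℕ+))) (fun a b hab => (Prod.ext_iff.mp hab).1)
  refine h.congr fun l => ?_
  simp only [Function.comp, ATerm]
  rw [MulChar.one_apply (isUnit_of_subsingleton _), MulChar.one_apply (isUnit_of_subsingleton _)]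
  simp only [one_mul, PNat.one_coe, Nat.cast_one, mul_one, div_one]
  ring_nf

/-- The Lipschitz summation formula twisted by a primitive character. -/
theorem gauss_mul_tsum_eq (hψ : ψ.IsPrimitive) {s w : ℂ} (hs : 2 < s.re) (hw : 0 < w.im) :
    gauss (star ψ) * ∑' n : ℕ+, ψ ((n : ℕ) : ZMod k) * (((n : ℕ) : ℂ) ^ (s - 1) *
        exp (2 * Real.pi * I * (w / k) * (n : ℕ))) =
      Gamma s * (-(k : ℂ) / (2 * Real.pi * I)) ^ s *
        ∑' n : ℤ, star ψ (n : ZMod k) * (w + n) ^ (-s) := by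
  have hk : (0 : ℝ) < k := by exact_mod_cast NeZero.pos k
  have him : ∀ r : ℕ, 0 < ((w + r) / k).im := by
    intro r
    rw [show ((k : ℂ)) = ((k : ℝ) : ℂ) by simp, div_ofReal_im]
    simp only [add_im, natCast_im, add_zero]
    positivity
  have hsum : Summable fun n : ℤ => star ψ (n : ZMod k) * (w + n) ^ (-s) := by
    refine Summable.of_norm_bounded (summable_int_add_cpow hw hs) fun n => ?_
    rw [norm_mul]
    exact mul_le_of_le_one_left (norm_nonneg _) ((star ψ).norm_le_one _)
  rw [tsum_int_eq_sum_fin (k := k) hsum, ← tsum_mul_left]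
  -- The Gauss sum expands ψ(n) into additive characters, each of which moves w/k to (w+r)/k; the
  -- Lipschitz formula at that point produces the integers qk + r of the class of r.
  calc _ = ∑' n : ℕ+, ∑ r : Fin k, star ψ ((r : ℕ) : ZMod k) * (((n : ℕ) : ℂ) ^ (s - 1) *
        exp (2 * Real.pi * I * ((w + (r : ℕ)) / k) * (n : ℕ))) := by
        refine tsum_congr fun n => ?_
        rw [← mul_assoc, gauss_star_mul hψ, Finset.sum_mul]
        refine Finset.sum_congr rfl fun r _ => ?_
        rw [mul_assoc, mul_left_comm (exp _), ← Complex.exp_add]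
        congr 3
        ring
    _ = ∑ r : Fin k, star ψ ((r : ℕ) : ZMod k) * ∑' n : ℕ+, (((n : ℕ) : ℂ) ^ (s - 1) *
        exp (2 * Real.pi * I * ((w + (r : ℕ)) / k) * (n : ℕ))) := by
        simp only [← tsum_mul_left]
        exact Summable.tsum_finsetSum fun r _ => (summable_pnat_cpow_mul_exp (him r)).mul_left _
    _ = _ := by
        rw [Finset.mul_sum]
        refine Finset.sum_congr rfl fun r _ => ?_
        rw [tsum_cpow_mul_exp_eq hs (him r), ← inv_two_pi_cpow]
        have : ∀ q : ℤ, star ψ ((q * k + (r : ℕ) : ℤ) : ZMod k) * (w + (q * k + (r : ℕ) : ℤ)) ^ (-s)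
            = star ψ ((r : ℕ) : ZMod k) * ((k : ℂ) ^ (-s) * ((w + (r : ℕ)) / k + q) ^ (-s)) := by
          intro q
          have hk' : (k : ℂ) ≠ 0 := by exact_mod_cast hk.ne'
          have e : (w + (r : ℕ)) / k + q = (w + (q * k + (r : ℕ) : ℤ)) / k := by
            push_cast
            field_simp
            ring
          rw [e, div_natCast_cpow_neg, ← mul_assoc ((k : ℂ) ^ (-s)), ← cpow_add _ _ hk']
          simp
        simp only [this, tsum_mul_left]
        have hk' : (k : ℂ) ≠ 0 := by exact_mod_cast hk.ne'
        have h1 : (k : ℂ) ^ s * (k : ℂ) ^ (-s) = 1 := by rw [← cpow_add _ _ hk']; simp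
        linear_combination (-(star ψ ((r : ℕ) : ZMod k) * ((-(2 * Real.pi * I)) ^ (-s) * Gamma s *
          ∑' n : ℤ, ((w + (r : ℕ)) / k + n) ^ (-s)))) * h1

end Lipschitz

/-! ### Möbius action and branches of powers of products. -/

theorem im_moebius {a b c d : ℤ} (hdet : a * d - b * c = 1) {z : ℂ} (hw : (c : ℂ) * z + d ≠ 0) :
    (moebius a b c d z).im = z.im / normSq ((c : ℂ) * z + d) := by
  have hN : normSq ((c : ℂ) * z + d) ≠ 0 := normSq_eq_zero.not.mpr hw
  have hdet' : (a * d - b * c : ℝ) = 1 := by exact_mod_cast hdet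
  rw [moebius, div_im, ← sub_div]
  congr 1
  simp
  linear_combination z.im * hdet'

theorem re_denom_pos {c d : ℤ} (hc : 0 < c) {z : ℂ} (hz : z ∈ quarterPlane c d) :
    0 < ((c : ℂ) * z + d).re := by
  have hc' : (0 : ℝ) < c := by exact_mod_cast hc
  have h := hz.1
  rw [div_lt_iff₀ hc'] at h
  simp
  linarith

theorem im_denom_pos {c d : ℤ} (hc : 0 < c) {z : ℂ} (hz : z ∈ quarterPlane c d) :
    0 < ((c : ℂ) * z + d).im := by
  have hc' : (0 : ℝ) < c := by exact_mod_cast hc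
  simpa [hc'] using hz.2

theorem im_moebius_pos {a b c d : ℤ} (hdet : a * d - b * c = 1) (hc : 0 < c) {z : ℂ}
    (hz : z ∈ quarterPlane c d) : 0 < (moebius a b c d z).im := by
  have hw : (c : ℂ) * z + d ≠ 0 := by
    intro h
    have := re_denom_pos hc hz
    rw [h] at this
    simp at this
  rw [im_moebius hdet hw]
  exact div_pos hz.2 (normSq_pos.mpr hw)

theorem im_mul_eq_sin (x y : ℂ) : (x * y).im = ‖x‖ * ‖y‖ * Real.sin (arg x + arg y) := by
  rw [Real.sin_add, mul_im]
  conv_lhs => rw [← norm_mul_cos_arg x, ← norm_mul_sin_arg x, ← norm_mul_cos_arg y,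
    ← norm_mul_sin_arg y]
  ring

/-- The arguments add up to a number in (0, 2π), and the sign of Im(xy) = |x||y| sin(arg x + arg y)
tells on which side of π it lies. -/
theorem cpow_mul_cpow_of_im_pos {x y : ℂ} (hx : 0 < x.im) (hy : 0 < y.im) (hxy : 0 < (x * y).im)
    (s : ℂ) : x ^ s * y ^ s = (x * y) ^ s := by
  have hx0 : x ≠ 0 := by rintro rfl; simp at hx
  have hy0 : y ≠ 0 := by rintro rfl; simp at hy
  have h1 := arg_mem_Ioo_of_im_pos hx
  have h2 := arg_mem_Ioo_of_im_pos hy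
  refine (mul_cpow_of_arg hx0 hy0 ⟨by linarith [h1.1, h2.1, Real.pi_pos], ?_⟩ s).symm
  by_contra! h
  have h3 : Real.sin (arg x + arg y) ≤ 0 := by
    rw [← Real.sin_sub_two_pi]
    exact Real.sin_nonpos_of_nonpos_of_neg_pi_le (by linarith [h1.2, h2.2]) (by linarith)
  have h4 : (x * y).im ≤ 0 := by
    rw [im_mul_eq_sin]
    exact mul_nonpos_of_nonneg_of_nonpos (by positivity) h3
  linarith

/-- Now the arguments add up to more than π, so log x + log y - πi is the principal logarithm of
-(xy). This jump is the source of e^{-πis} in the transformation law. -/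
theorem cpow_mul_cpow_of_im_neg {x y : ℂ} (hx : 0 < x.im) (hy : 0 < y.im) (hxy : (x * y).im < 0)
    (s : ℂ) : x ^ s * y ^ s = exp (Real.pi * I * s) * (-(x * y)) ^ s := by
  have hx0 : x ≠ 0 := by rintro rfl; simp at hx
  have hy0 : y ≠ 0 := by rintro rfl; simp at hy
  have h1 := arg_mem_Ioo_of_im_pos hx
  have h2 := arg_mem_Ioo_of_im_pos hy
  have h : Real.pi < arg x + arg y := by
    by_contra! h
    have h4 : 0 ≤ (x * y).im := by
      rw [im_mul_eq_sin]
      exact mul_nonneg (by positivity)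
        (Real.sin_nonneg_of_nonneg_of_le_pi (by linarith [h1.1, h2.1]) h)
    linarith
  have hl : log (-(x * y)) = log x + log y - Real.pi * I := by
    rw [← log_exp (x := log x + log y - Real.pi * I), Complex.exp_sub, Complex.exp_add,
      exp_log hx0, exp_log hy0, exp_pi_mul_I, div_neg, div_one]
    · simp [log_im]; linarith [Real.pi_pos]
    · simp [log_im]; linarith [h1.2, h2.2]
  rw [cpow_def_of_ne_zero hx0, cpow_def_of_ne_zero hy0,
    cpow_def_of_ne_zero (neg_ne_zero.mpr (mul_ne_zero hx0 hy0)), hl, ← Complex.exp_add,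
    ← Complex.exp_add]
  ring_nf

/-! ### Half-plane lattice sums and their transformation. -/

/-- The term `ψ(M) ψ̄(N) (M z + N)^{-s}` of a character Eisenstein series. -/
noncomputable def latticeTerm {k : ℕ} (ψ : DirichletCharacter ℂ k) (s z : ℂ) (p : ℤ × ℤ) : ℂ :=
  ψ (p.1 : ZMod k) * star ψ (p.2 : ZMod k) * ((p.1 : ℂ) * z + p.2) ^ (-s)

/-- The sum of `latticeTerm` over the half-plane `M > 0`. -/
noncomputable def halfSum {k : ℕ} (ψ : DirichletCharacter ℂ k) (s z : ℂ) : ℂ :=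
  ∑' p, {p : ℤ × ℤ | 0 < p.1}.indicator (latticeTerm ψ s z) p

/-- The sum of `latticeTerm` over the cone `M > 0`, `c N > d M`. -/
noncomputable def coneSum {k : ℕ} (ψ : DirichletCharacter ℂ k) (s z : ℂ) (c d : ℤ) : ℂ :=
  ∑' p, {p : ℤ × ℤ | 0 < p.1 ∧ d * p.1 < c * p.2}.indicator (latticeTerm ψ s z) p

section Lattice

variable {k : ℕ} (χ ψ : DirichletCharacter ℂ k)

theorem summable_latticeTerm {s z : ℂ} (hs : 2 < s.re) (hz : 0 < z.im) :
    Summable (latticeTerm ψ s z) := by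
  refine Summable.of_norm_bounded (summable_lattice hz hs) fun p => ?_
  rw [latticeTerm, norm_mul, norm_mul]
  refine mul_le_of_le_one_left (norm_nonneg _) ?_
  exact mul_le_one₀ (ψ.norm_le_one _) (norm_nonneg _) ((star ψ).norm_le_one _)

variable {ψ} in
/-- The Lipschitz formula turns the series `A` into a sum over a half-plane of lattice points. -/
theorem gauss_mul_A [NeZero k] (hψ : ψ.IsPrimitive) {s z : ℂ} (hs : 2 < s.re) (hz : 0 < z.im) :
    gauss (star ψ) * A z s ψ =
      Gamma s * (-(k : ℂ) / (2 * Real.pi * I)) ^ s * halfSum ψ s z := by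
  have hA : A z s ψ = ∑' m : ℕ+, ∑' n : ℕ+, ATerm ψ s z (n, m) := by
    rw [A, ← (Equiv.prodComm ℕ+ ℕ+).tsum_eq]
    have h2 := summable_ATerm ψ s hz
    rw [← (Equiv.prodComm ℕ+ ℕ+).summable_iff] at h2
    exact Summable.tsum_prod h2
  have hE : halfSum ψ s z = ∑' m : ℕ+, ∑' n : ℤ, latticeTerm ψ s z ((m : ℕ), n) := by
    rw [halfSum, Summable.tsum_prod ((summable_latticeTerm ψ hs hz).indicator _),
      tsum_int_eq_tsum_pnat]
    · refine tsum_congr fun m => tsum_congr fun n => ?_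
      rw [indicator_of_mem]
      simp
    · intro M hM
      simp only [indicator, mem_ofPred_eq, not_lt.mpr hM, if_false, tsum_zero]
  rw [hA, hE, ← tsum_mul_left, ← tsum_mul_left]
  refine tsum_congr fun m => ?_
  have hw : 0 < (((m : ℕ) : ℂ) * z).im := by
    have : (0 : ℝ) < (m : ℕ) := by exact_mod_cast m.pos
    simp; positivity
  have h := gauss_mul_tsum_eq hψ hs hw
  have e1 : ∑' n : ℕ+, ATerm ψ s z (n, m) = ψ ((m : ℕ) : ZMod k) * ∑' n : ℕ+,
      ψ ((n : ℕ) : ZMod k) * (((n : ℕ) : ℂ) ^ (s - 1) *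
        exp (2 * Real.pi * I * ((m : ℕ) * z / k) * (n : ℕ))) := by
    rw [← tsum_mul_left]
    refine tsum_congr fun n => ?_
    simp only [ATerm]
    rw [show 2 * Real.pi * I * ((m : ℕ) * z / k) * (n : ℕ) =
      2 * Real.pi * I * (m : ℕ) * (n : ℕ) * z / k by ring]
    ring
  have e2 : ∑' n : ℤ, latticeTerm ψ s z ((m : ℕ), n) = ψ ((m : ℕ) : ZMod k) * ∑' n : ℤ,
      star ψ (n : ZMod k) * ((m : ℕ) * z + n) ^ (-s) := by
    rw [← tsum_mul_left]
    refine tsum_congr fun n => ?_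
    simp only [latticeTerm, Int.cast_natCast, mul_assoc]
  rw [e1, e2]
  linear_combination ψ ((m : ℕ) : ZMod k) * h

/-- The change of lattice points induced by a matrix of determinant one. -/
def latticeEquiv {a b c d : ℤ} (hdet : a * d - b * c = 1) : ℤ × ℤ ≃ ℤ × ℤ where
  toFun p := (p.1 * d - p.2 * c, p.2 * a - p.1 * b)
  invFun p := (p.1 * a + p.2 * c, p.1 * b + p.2 * d)
  left_inv p := by
    ext
    · linear_combination p.1 * hdet
    · linear_combination p.2 * hdet
  right_inv p := by
    ext
    · linear_combination p.1 * hdet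
    · linear_combination p.2 * hdet

theorem latticeEquiv_apply {a b c d : ℤ} (hdet : a * d - b * c = 1) (M N : ℤ) :
    latticeEquiv hdet (M, N) = (M * d - N * c, N * a - M * b) := rfl

/-- Since ψ(-1)ψ̄(-1) = 1, only the power feels the reflection. -/
theorem latticeTerm_neg (s z : ℂ) (p : ℤ × ℤ) :
    latticeTerm ψ s z (-p) = ψ (p.1 : ZMod k) * star ψ (p.2 : ZMod k) *
      (-((p.1 : ℂ) * z + p.2)) ^ (-s) := by
  have h1 : ψ (-1) * star ψ (-1) = 1 := by
    rw [MulChar.star_eq_inv, ← MulChar.mul_apply, mul_inv_cancel,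
      MulChar.one_apply (isUnit_one.neg)]
  simp only [latticeTerm, Prod.fst_neg, Prod.snd_neg, Int.cast_neg]
  rw [← neg_one_mul (p.1 : ZMod k), ← neg_one_mul (p.2 : ZMod k), map_mul, map_mul,
    show (-(p.1 : ℂ)) * z + -(p.2 : ℂ) = -((p.1 : ℂ) * z + p.2) by ring]
  linear_combination (ψ (p.1 : ZMod k) * star ψ (p.2 : ZMod k) *
    (-((p.1 : ℂ) * z + p.2)) ^ (-s)) * h1

theorem denom_mul_moebius {a b c d : ℤ} (hdet : a * d - b * c = 1) {z : ℂ}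
    (hw0 : (c : ℂ) * z + d ≠ 0) (M N : ℤ) :
    ((c : ℂ) * z + d) * (((M * d - N * c : ℤ) : ℂ) * moebius a b c d z + ((N * a - M * b : ℤ) : ℂ))
      = (M : ℂ) * z + N := by
  have hdet' : (a * d - b * c : ℂ) = 1 := by exact_mod_cast hdet
  rw [moebius, mul_add, mul_left_comm, mul_div_cancel₀ _ hw0]
  push_cast
  linear_combination ((M : ℂ) * z + N) * hdet'

theorem im_lattice {z : ℂ} (M N : ℤ) : ((M : ℂ) * z + N).im = M * z.im := by simp

-- With m = Md - Nc and n = Na - Mb one has (cz+d)(mTz+n) = Mz+N, and m > 0 means cN < dM. If M > 0,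
-- the powers multiply. If M < 0, the product lies in the lower half-plane and the term is e^{-πis}
-- times the one at the reflected point, which lies in the cone. If M = 0, the term vanishes with
-- ψ(0).
variable {χ ψ} in
theorem latticeTerm_moebius {a b c d : ℤ} (hdet : a * d - b * c = 1) (hc : 0 < c) {z : ℂ}
    (hz : z ∈ quarterPlane c d) {s κ : ℂ}
    (hκ : ∀ M N : ℤ, χ ((M * d - N * c : ℤ) : ZMod k) * star χ ((N * a - M * b : ℤ) : ZMod k) =
      κ * (ψ (M : ZMod k) * star ψ (N : ZMod k)))
    (h0 : ψ 0 = 0) (p : ℤ × ℤ) :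
    ((c : ℂ) * z + d) ^ (-s) * {p : ℤ × ℤ | 0 < p.1}.indicator
      (latticeTerm χ s (moebius a b c d z)) (latticeEquiv hdet p) =
      κ * ({p : ℤ × ℤ | 0 < p.1 ∧ c * p.2 < d * p.1}.indicator (latticeTerm ψ s z) p +
        exp (-Real.pi * I * s) *
        {p : ℤ × ℤ | 0 < p.1 ∧ d * p.1 < c * p.2}.indicator (latticeTerm ψ s z) (-p)) := by
  obtain ⟨M, N⟩ := p
  have hzi : 0 < z.im := hz.2
  have hT := im_moebius_pos hdet hc hz
  have hwi := im_denom_pos hc hz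
  have hw0 : (c : ℂ) * z + d ≠ 0 := by intro h; rw [h] at hwi; simp at hwi
  have hwy := denom_mul_moebius hdet hw0 M N
  rw [latticeEquiv_apply]
  simp only [indicator, mem_ofPred_eq, Prod.fst_neg, Prod.snd_neg, latticeTerm_neg]
  simp only [latticeTerm]
  by_cases hm : 0 < M * d - N * c
  swap
  · rw [if_neg hm, if_neg (by intro h; linarith [h.2]), if_neg (by intro h; linarith [h.2])]
    simp
  have hyi : 0 < (((M * d - N * c : ℤ) : ℂ) * moebius a b c d z + ((N * a - M * b : ℤ) : ℂ)).im := by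
    have h' : (0 : ℝ) < (M * d - N * c : ℤ) := by exact_mod_cast hm
    rw [im_lattice]
    positivity
  rw [if_pos hm, hκ]
  generalize ((M * d - N * c : ℤ) : ℂ) * moebius a b c d z + ((N * a - M * b : ℤ) : ℂ) = y at *
  generalize (c : ℂ) * z + d = w at *
  have him : (w * y).im = M * z.im := by rw [hwy, im_lattice]
  rcases lt_trichotomy M 0 with hM | hM | hM
  · have hneg : (w * y).im < 0 := by
      rw [him]
      exact mul_neg_of_neg_of_pos (by exact_mod_cast hM) hzi
    rw [if_neg (by intro h; linarith [h.1]), if_pos (by constructor <;> linarith)]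
    have h := cpow_mul_cpow_of_im_neg hwi hyi hneg (-s)
    rw [hwy] at h
    rw [show -Real.pi * I * s = Real.pi * I * -s by ring]
    linear_combination κ * (ψ (M : ZMod k) * star ψ (N : ZMod k)) * h
  · subst hM
    simp [h0]
  · have hpos : 0 < (w * y).im := by
      rw [him]
      exact mul_pos (by exact_mod_cast hM) hzi
    rw [if_pos (by constructor <;> linarith), if_neg (by intro h; linarith [h.1])]
    have h := cpow_mul_cpow_of_im_pos hwi hyi hpos (-s)
    rw [hwy] at h
    linear_combination κ * (ψ (M : ZMod k) * star ψ (N : ZMod k)) * h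

-- The ray cN = dM separates the two parts of the half-plane, and its points are annihilated by
-- `hv`.
variable {ψ} in
theorem halfSum_eq_add {c d : ℤ} {z s : ℂ} (hsum : Summable (latticeTerm ψ s z))
    (hv : ∀ M N : ℤ, c * N = d * M → ψ (M : ZMod k) * star ψ (N : ZMod k) = 0) :
    halfSum ψ s z = ∑' p, {p : ℤ × ℤ | 0 < p.1 ∧ c * p.2 < d * p.1}.indicator (latticeTerm ψ s z) p
      + coneSum ψ s z c d := by
  rw [coneSum, halfSum, ← Summable.tsum_add (hsum.indicator _) (hsum.indicator _)]
  refine tsum_congr fun p => ?_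
  simp only [indicator, mem_ofPred_eq]
  by_cases hp : 0 < p.1
  · rcases lt_trichotomy (c * p.2) (d * p.1) with h | h | h
    · simp [hp, h, h.le]
    · have h0 : latticeTerm ψ s z p = 0 := by rw [latticeTerm, hv _ _ h, zero_mul]
      simp [hp, h, h0]
    · simp [hp, h, h.le]
  · simp [hp]

-- After reindexing there remain the half-plane without the cone, and e^{-πis} times the cone;
-- completing the first to the full half-plane leaves e^{-πis} - 1 as the coefficient of the cone.
variable {χ ψ} in
theorem halfSum_moebius {a b c d : ℤ} (hdet : a * d - b * c = 1) (hc : 0 < c) {z : ℂ}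
    (hz : z ∈ quarterPlane c d) {s κ : ℂ} (hs : 2 < s.re)
    (hκ : ∀ M N : ℤ, χ ((M * d - N * c : ℤ) : ZMod k) * star χ ((N * a - M * b : ℤ) : ZMod k) =
      κ * (ψ (M : ZMod k) * star ψ (N : ZMod k)))
    (h0 : ψ 0 = 0)
    (hv : ∀ M N : ℤ, c * N = d * M → ψ (M : ZMod k) * star ψ (N : ZMod k) = 0) :
    ((c : ℂ) * z + d) ^ (-s) * halfSum χ s (moebius a b c d z) =
      κ * (halfSum ψ s z + (exp (-Real.pi * I * s) - 1) * coneSum ψ s z c d) := by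
  have hsum := summable_latticeTerm ψ hs hz.2
  have hcone : coneSum ψ s z c d = ∑' p, {p : ℤ × ℤ | 0 < p.1 ∧ d * p.1 < c * p.2}.indicator
      (latticeTerm ψ s z) (-p) := by
    rw [coneSum, ← (Equiv.neg (ℤ × ℤ)).tsum_eq]
    rfl
  have hVs : Summable fun p => {p : ℤ × ℤ | 0 < p.1 ∧ d * p.1 < c * p.2}.indicator
      (latticeTerm ψ s z) (-p) :=
    (Equiv.neg (ℤ × ℤ)).summable_iff.mpr (hsum.indicator _)
  rw [halfSum, ← (latticeEquiv hdet).tsum_eq, ← tsum_mul_left,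
    tsum_congr (latticeTerm_moebius hdet hc hz hκ h0), tsum_mul_left,
    Summable.tsum_add (hsum.indicator _) (hVs.mul_left _), tsum_mul_left, ← hcone,
    halfSum_eq_add hsum hv]
  ring

end Lattice

/-! ### Loop integrals: convergence and holomorphy in s. -/

/-- A function that is holomorphic on and inside the loop of `loopIntegral δ` except for a pole of
order at most two at the origin, and that decays exponentially at the end of the loop. -/
structure IsLoopKernel (δ : ℝ) (K : ℂ → ℂ) : Prop where
  pos : 0 < δ
  differentiableAt : ∀ u ∈ loopRegion δ, u ≠ 0 → DifferentiableAt ℂ K u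
  pole : ∃ C ε : ℝ, 0 < ε ∧ ∀ u, ‖u‖ < ε → ‖K u‖ * ‖u‖ ^ (2 : ℝ) ≤ C
  decay : ∃ C b T : ℝ, 0 < b ∧ ∀ u : ℂ, T ≤ u.re → |u.im| ≤ δ → ‖K u‖ ≤ C * Real.exp (-b * u.re)

theorem norm_cpow_le' (x s : ℂ) : ‖x ^ s‖ ≤ ‖x‖ ^ s.re * Real.exp (Real.pi * |s.im|) := by
  simpa using norm_cpow_neg_le x (-s)

theorem exp_mul_branchLog {u : ℂ} (hu : u ≠ 0) (s : ℂ) :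
    exp (s * branchLog u) = (-u) ^ s * exp (s * (Real.pi * I)) := by
  rw [branchLog, mul_add, Complex.exp_add, cpow_def_of_ne_zero (neg_ne_zero.mpr hu), mul_comm s]

/-- Re s - 1 lies between Re s₀ - 2 and Re s₀, so one of the two powers dominates for ‖u‖ ≥ 1 and
the other for ‖u‖ ≤ 1. The result is a majorant independent of s, as differentiation under the
integral requires. -/
theorem norm_exp_mul_branchLog_le {u s s₀ : ℂ} (hu : u ≠ 0) (hs : s ∈ Metric.ball s₀ 1) :
    ‖exp ((s - 1) * branchLog u)‖ ≤ (‖u‖ ^ s₀.re + ‖u‖ ^ (s₀.re - 2)) *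
      Real.exp (2 * Real.pi * (|s₀.im| + 1)) := by
  have hpi := Real.pi_pos
  have hu' : 0 < ‖u‖ := norm_pos_iff.mpr hu
  rw [Metric.mem_ball, dist_eq_norm] at hs
  have h1 : |s.re - s₀.re| < 1 := by simpa using (abs_re_le_norm (s - s₀)).trans_lt hs
  have h2 : |s.im - s₀.im| < 1 := by simpa using (abs_im_le_norm (s - s₀)).trans_lt hs
  have h3 : |s.im| ≤ |s₀.im| + 1 := by
    have := abs_sub_abs_le_abs_sub s.im s₀.im
    linarith
  rw [abs_lt] at h1
  rw [exp_mul_branchLog hu, norm_mul, norm_exp]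
  have h4 : ‖(-u) ^ (s - 1)‖ ≤ (‖u‖ ^ s₀.re + ‖u‖ ^ (s₀.re - 2)) *
      Real.exp (Real.pi * (|s₀.im| + 1)) := by
    refine (norm_cpow_le' _ _).trans ?_
    rw [norm_neg, sub_re, one_re, sub_im, one_im, sub_zero]
    gcongr
    rcases le_total 1 ‖u‖ with h | h
    · have := Real.rpow_le_rpow_of_exponent_le h (by linarith : s.re - 1 ≤ s₀.re)
      have := Real.rpow_nonneg hu'.le (s₀.re - 2)
      linarith
    · have := Real.rpow_le_rpow_of_exponent_ge hu' h (by linarith : s₀.re - 2 ≤ s.re - 1)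
      have := Real.rpow_nonneg hu'.le s₀.re
      linarith
  have h5 : ((s - 1) * (Real.pi * I)).re ≤ Real.pi * (|s₀.im| + 1) := by
    have : ((s - 1) * (Real.pi * I)).re = Real.pi * -s.im := by simp; ring
    rw [this]
    gcongr
    exact (neg_le_abs _).trans h3
  calc _ ≤ (‖u‖ ^ s₀.re + ‖u‖ ^ (s₀.re - 2)) * Real.exp (Real.pi * (|s₀.im| + 1)) *
        Real.exp (Real.pi * (|s₀.im| + 1)) := by gcongr
    _ = _ := by rw [mul_assoc, ← Real.exp_add]; ring_nf

theorem continuousAt_branchLog {u : ℂ} (hu : u.re < 0 ∨ u.im ≠ 0) : ContinuousAt branchLog u := by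
  unfold branchLog
  refine (ContinuousAt.clog continuousAt_neg ?_).add continuousAt_const
  rcases hu with h | h
  · exact Or.inl (by simpa using h)
  · exact Or.inr (by simpa using h)

theorem mem_loopRegion_add {δ t h : ℝ} (ht : 0 ≤ t) (hh : |h| ≤ δ) :
    ((t : ℂ) + h * I) ∈ loopRegion δ := Or.inr (by simpa using ⟨ht, hh⟩)

theorem add_mul_I_ne_zero {t h : ℝ} (hh : h ≠ 0) : ((t : ℂ) + h * I) ≠ 0 := fun h0 => hh (by
  simpa using congrArg im h0)

namespace IsLoopKernel

variable {δ : ℝ} {K : ℂ → ℂ}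

/-- Half of the decay rate absorbs the power, since ‖t + hi‖ lies between 1 and 2t for large t. -/
theorem exists_decay_mul_rpow (hK : IsLoopKernel δ K) (a : ℝ) : ∃ C b T : ℝ, 0 < b ∧ ∀ t h : ℝ, T ≤ t → |h| ≤ δ →
    ‖K (t + h * I)‖ * ‖((t : ℂ) + h * I)‖ ^ a ≤ C * Real.exp (-b * t) := by
  obtain ⟨C, b, T, hb, hT⟩ := hK.decay
  obtain ⟨C', hC'⟩ := (isLittleO_rpow_exp_pos_mul_atTop |a| (half_pos hb)).isBigO.bound
  obtain ⟨T', hT'⟩ := eventually_atTop.mp hC'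
  refine ⟨C * (2 ^ |a| * C'), b / 2, max (max T T') (max δ 1), half_pos hb, fun t h ht hh => ?_⟩
  simp only [max_le_iff] at ht
  have h1 := hT (t + h * I) (by simpa using ht.1.1) (by simpa using hh)
  have h2 := hT' t ht.1.2
  have ht0 : 0 < t := by linarith [ht.2.2]
  rw [Real.norm_of_nonneg (by positivity), Real.norm_of_nonneg (Real.exp_pos _).le] at h2
  simp only [add_re, ofReal_re, mul_re, I_re, mul_zero, ofReal_im, I_im, mul_one, sub_self,
    add_zero] at h1
  have hn1 : 1 ≤ ‖((t : ℂ) + h * I)‖ := by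
    have := (abs_re_le_norm ((t : ℂ) + h * I))
    simp [abs_of_pos ht0] at this
    linarith [ht.2.2]
  have hn2 : ‖((t : ℂ) + h * I)‖ ≤ 2 * t := by
    refine (norm_add_le _ _).trans ?_
    simp only [norm_real, norm_mul, norm_I, mul_one, Real.norm_eq_abs, abs_of_pos ht0]
    linarith [ht.2.1]
  have h3 : ‖((t : ℂ) + h * I)‖ ^ a ≤ 2 ^ |a| * C' * Real.exp (b / 2 * t) := by
    calc _ ≤ ‖((t : ℂ) + h * I)‖ ^ |a| := Real.rpow_le_rpow_of_exponent_le hn1 (le_abs_self a)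
      _ ≤ (2 * t) ^ |a| := by gcongr
      _ = 2 ^ |a| * t ^ |a| := Real.mul_rpow (by norm_num) ht0.le
      _ ≤ 2 ^ |a| * (C' * Real.exp (b / 2 * t)) := by gcongr
      _ = _ := by ring
  calc _ ≤ (C * Real.exp (-b * t)) * (2 ^ |a| * C' * Real.exp (b / 2 * t)) :=
        mul_le_mul h1 h3 (by positivity) ((norm_nonneg _).trans h1)
    _ = C * (2 ^ |a| * C') * (Real.exp (-b * t) * Real.exp (b / 2 * t)) := by ring
    _ = _ := by rw [← Real.exp_add]; ring_nf

theorem continuousOn_line (hK : IsLoopKernel δ K) {h : ℝ} (hh : |h| ≤ δ) (h0 : h ≠ 0) :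
    ContinuousOn (fun t : ℝ => K (t + h * I)) (Ici 0) := fun t ht =>
  ((hK.differentiableAt _ (mem_loopRegion_add ht hh) (add_mul_I_ne_zero h0)).continuousAt.comp
    (f := fun t : ℝ => (t : ℂ) + h * I) (by fun_prop)).continuousWithinAt

theorem integrableOn_line_bound (hK : IsLoopKernel δ K) {h : ℝ} (hh : |h| ≤ δ) (h0 : h ≠ 0) (a : ℝ) :
    IntegrableOn (fun t : ℝ => ‖K (t + h * I)‖ * ‖((t : ℂ) + h * I)‖ ^ a) (Ioi 0) := by
  obtain ⟨C, b, T, hb, hT⟩ := hK.exists_decay_mul_rpow a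
  refine integrable_of_isBigO_exp_neg hb ?_ (Asymptotics.IsBigO.of_bound C ?_)
  · refine (hK.continuousOn_line hh h0).norm.mul (fun t _ => ?_)
    refine (ContinuousAt.rpow_const (by fun_prop) (Or.inl ?_)).continuousWithinAt
    exact norm_ne_zero_iff.mpr (add_mul_I_ne_zero h0)
  · filter_upwards [eventually_ge_atTop T] with t ht
    rw [Real.norm_of_nonneg (by positivity), Real.norm_of_nonneg (Real.exp_pos _).le]
    exact hT t h ht hh

theorem aestronglyMeasurable_line (hK : IsLoopKernel δ K) {h : ℝ} (hh : |h| ≤ δ) (h0 : h ≠ 0) (s : ℂ) :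
    AEStronglyMeasurable (fun t : ℝ => K (t + h * I) * exp ((s - 1) * branchLog (t + h * I)))
      (volume.restrict (Ioi 0)) := by
  refine ContinuousOn.aestronglyMeasurable ?_ measurableSet_Ioi
  refine ((hK.continuousOn_line hh h0).mono Ioi_subset_Ici_self).mul fun t _ => ?_
  have h1 : ContinuousAt (fun t : ℝ => branchLog (t + h * I)) t :=
    (continuousAt_branchLog (Or.inr (by simpa using h0))).comp
      (f := fun t : ℝ => (t : ℂ) + h * I) (by fun_prop)
  exact (continuous_exp.continuousAt.comp (continuousAt_const.mul h1)).continuousWithinAt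

theorem norm_line_le {h : ℝ} (h0 : h ≠ 0) {s s₀ : ℂ} (hs : s ∈ Metric.ball s₀ 1) (t : ℝ) :
    ‖K (t + h * I) * exp ((s - 1) * branchLog (t + h * I))‖ ≤
      (‖K (t + h * I)‖ * ‖((t : ℂ) + h * I)‖ ^ s₀.re +
        ‖K (t + h * I)‖ * ‖((t : ℂ) + h * I)‖ ^ (s₀.re - 2)) *
      Real.exp (2 * Real.pi * (|s₀.im| + 1)) := by
  rw [norm_mul, ← mul_add, mul_assoc]
  exact mul_le_mul_of_nonneg_left (norm_exp_mul_branchLog_le (add_mul_I_ne_zero h0) hs)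
    (norm_nonneg _)

theorem integrableOn_line_majorant (hK : IsLoopKernel δ K) {h : ℝ} (hh : |h| ≤ δ) (h0 : h ≠ 0)
    (s₀ : ℂ) : IntegrableOn (fun t : ℝ => (‖K (t + h * I)‖ * ‖((t : ℂ) + h * I)‖ ^ s₀.re +
        ‖K (t + h * I)‖ * ‖((t : ℂ) + h * I)‖ ^ (s₀.re - 2)) *
      Real.exp (2 * Real.pi * (|s₀.im| + 1))) (Ioi 0) :=
  ((hK.integrableOn_line_bound hh h0 s₀.re).add
    (hK.integrableOn_line_bound hh h0 (s₀.re - 2))).mul_const _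

theorem integrableOn_line (hK : IsLoopKernel δ K) {h : ℝ} (hh : |h| ≤ δ) (h0 : h ≠ 0) (s : ℂ) :
    IntegrableOn (fun t : ℝ => K (t + h * I) * exp ((s - 1) * branchLog (t + h * I))) (Ioi 0) := by
  refine Integrable.mono' (hK.integrableOn_line_majorant hh h0 s)
    (hK.aestronglyMeasurable_line hh h0 s) (Eventually.of_forall fun t => ?_)
  exact norm_line_le h0 (Metric.mem_ball_self one_pos) t

theorem differentiable_line (hK : IsLoopKernel δ K) {h : ℝ} (hh : |h| ≤ δ) (h0 : h ≠ 0) :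
    Differentiable ℂ fun s => ∫ t in Ioi (0 : ℝ),
      K (t + h * I) * exp ((s - 1) * branchLog (t + h * I)) := fun s₀ => by
  refine differentiableAt_integral_of_dominated one_pos
    (fun s _ => hK.aestronglyMeasurable_line hh h0 s) ?_
    (Eventually.of_forall fun t s hs => norm_line_le h0 hs t)
    (hK.integrableOn_line_majorant hh h0 s₀)
  exact Eventually.of_forall fun t => by fun_prop

theorem circle_mem {δ : ℝ} (hδ : 0 < δ) (θ : ℝ) :
    (δ * exp (θ * I) : ℂ) ∈ loopRegion δ ∧ (δ * exp (θ * I) : ℂ) ≠ 0 := by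
  refine ⟨Or.inl ?_, by simp [hδ.ne']⟩
  rw [norm_mul, norm_exp_ofReal_mul_I, norm_real, Real.norm_of_nonneg hδ.le, mul_one]

theorem branchLog_circle {r : ℝ} (hr : 0 < r) {θ : ℝ} (hθ : θ ∈ Icc (Real.pi / 2) (3 * Real.pi / 2)) :
    branchLog (r * exp (θ * I)) = Real.log r + θ * I := by
  have hpi := Real.pi_pos
  have e : -(r * exp (θ * I)) = exp (Real.log r + (θ - Real.pi : ℝ) * I) := by
    rw [Complex.exp_add, ← ofReal_exp, Real.exp_log hr, ofReal_sub, sub_mul, Complex.exp_sub,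
      exp_pi_mul_I, div_neg, div_one, mul_neg]
  rw [branchLog, e, log_exp]
  · push_cast; ring
  · simp; linarith [hθ.1]
  · simp; linarith [hθ.2]

theorem uIcc_half_circle :
    uIcc (Real.pi / 2) (3 * Real.pi / 2) = Icc (Real.pi / 2) (3 * Real.pi / 2) :=
  uIcc_of_le (by linarith [Real.pi_pos])

/-- The integrand on the circular part of the loop. -/
theorem circle_integrand_congr {r : ℝ} (hr : 0 < r) (s : ℂ) :
    EqOn (fun θ : ℝ => K (r * exp (θ * I)) * exp ((s - 1) * branchLog (r * exp (θ * I))) *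
        (I * (r * exp (θ * I))))
      (fun θ : ℝ => I * (K (r * exp (θ * I)) * exp (s * (Real.log r + θ * I))))
      (uIcc (Real.pi / 2) (3 * Real.pi / 2)) := by
  intro θ hθ
  rw [uIcc_half_circle] at hθ
  have e : (r * exp (θ * I) : ℂ) = exp (Real.log r + θ * I) := by
    rw [Complex.exp_add, ← ofReal_exp, Real.exp_log hr]
  beta_reduce
  rw [branchLog_circle hr hθ]
  generalize hL : (Real.log r + θ * I : ℂ) = L at *
  have e2 : exp (s * L) = exp ((s - 1) * L) * exp L := by rw [← Complex.exp_add]; ring_nf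
  rw [e2, e]
  ring

theorem continuous_circle (hK : IsLoopKernel δ K) :
    Continuous fun θ : ℝ => K (δ * exp (θ * I)) :=
  continuous_iff_continuousAt.mpr fun θ =>
    (hK.differentiableAt _ (circle_mem hK.pos θ).1 (circle_mem hK.pos θ).2).continuousAt.comp
      (f := fun θ : ℝ => (δ * exp (θ * I) : ℂ)) (by fun_prop)

theorem intervalIntegrable_circle (hK : IsLoopKernel δ K) (s : ℂ) :
    IntervalIntegrable (fun θ : ℝ => K (δ * exp (θ * I)) *
        exp ((s - 1) * branchLog (δ * exp (θ * I))) * (I * (δ * exp (θ * I)))) volume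
      (Real.pi / 2) (3 * Real.pi / 2) := by
  rw [intervalIntegrable_congr fun θ hθ => circle_integrand_congr hK.pos s (uIoc_subset_uIcc hθ)]
  exact (continuous_const.mul (hK.continuous_circle.mul (by fun_prop))).intervalIntegrable _ _

theorem differentiable_circle (hK : IsLoopKernel δ K) :
    Differentiable ℂ fun s => ∫ θ in (Real.pi / 2)..(3 * Real.pi / 2), K (δ * exp (θ * I)) *
        exp ((s - 1) * branchLog (δ * exp (θ * I))) * (I * (δ * exp (θ * I))) := by
  simp only [intervalIntegral.integral_congr (circle_integrand_congr hK.pos _)]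
  intro s₀
  simp only [intervalIntegral.integral_of_le (by linarith [Real.pi_pos] :
    Real.pi / 2 ≤ 3 * Real.pi / 2)]
  have hc := hK.continuous_circle
  refine differentiableAt_integral_of_dominated one_pos (bound := fun θ : ℝ =>
    ‖K (δ * exp (θ * I))‖ * Real.exp ((‖s₀‖ + 1) * ‖(Real.log δ + θ * I : ℂ)‖)) (fun s _ => ?_) ?_
    (Eventually.of_forall fun θ s hs => ?_) ?_
  · exact (continuous_const.mul (hc.mul (by fun_prop))).aestronglyMeasurable
  · exact Eventually.of_forall fun t => by fun_prop
  · rw [norm_mul, norm_I, one_mul, norm_mul]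
    gcongr
    refine (norm_exp_le_exp_norm _).trans ?_
    rw [norm_mul]
    gcongr
    rw [Metric.mem_ball, dist_eq_norm] at hs
    linarith [norm_le_norm_add_norm_sub' s s₀]
  · exact (Continuous.integrableOn_Icc (hc.norm.mul (by fun_prop))).mono_set Ioc_subset_Icc_self

theorem line_neg (h : ℝ) (t : ℝ) : (t : ℂ) - h * I = t + (-h : ℝ) * I := by
  push_cast; ring

theorem abs_width_le (hK : IsLoopKernel δ K) : |δ| ≤ δ := (abs_of_pos hK.pos).le

theorem abs_neg_width_le (hK : IsLoopKernel δ K) : |-δ| ≤ δ := by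
  rw [abs_neg]; exact hK.abs_width_le

theorem loopIntegrable (hK : IsLoopKernel δ K) (s : ℂ) :
    LoopIntegrable δ fun u => K u * exp ((s - 1) * branchLog u) := by
  refine ⟨hK.integrableOn_line hK.abs_width_le hK.pos.ne' s, hK.intervalIntegrable_circle s, ?_⟩
  simp only [line_neg]
  exact hK.integrableOn_line hK.abs_neg_width_le (neg_ne_zero.mpr hK.pos.ne') s

theorem differentiable_loopIntegral (hK : IsLoopKernel δ K) :
    Differentiable ℂ fun s => loopIntegral δ fun u => K u * exp ((s - 1) * branchLog u) := by
  unfold loopIntegral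
  simp only [line_neg]
  exact ((hK.differentiable_line hK.abs_width_le hK.pos.ne').neg.add hK.differentiable_circle).add
    (hK.differentiable_line hK.abs_neg_width_le (neg_ne_zero.mpr hK.pos.ne'))

end IsLoopKernel

/-! ### Collapsing the loop onto the half-line. -/

theorem log_eq_branchLog_of_im_pos {u : ℂ} (hu : 0 < u.im) : branchLog u = log u := by
  have h := arg_mem_Ioo_of_im_pos hu
  have hu0 : u ≠ 0 := by rintro rfl; simp at hu
  have e : -u = exp (log u - Real.pi * I) := by
    rw [Complex.exp_sub, exp_log hu0, exp_pi_mul_I, div_neg, div_one]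
  rw [branchLog, e, log_exp]
  · ring
  · simp [log_im]; linarith [h.1]
  · simp [log_im]; linarith [h.2, Real.pi_pos]

theorem branchLog_of_im_neg {u : ℂ} (hu : u.im < 0) : branchLog u = log u + 2 * Real.pi * I := by
  have h : arg u < 0 := arg_neg_iff.mpr hu
  have h' := neg_pi_lt_arg u
  have hu0 : u ≠ 0 := by rintro rfl; simp at hu
  have e : -u = exp (log u + Real.pi * I) := by
    rw [Complex.exp_add, exp_log hu0, exp_pi_mul_I, mul_neg_one]
  rw [branchLog, e, log_exp]
  · ring
  · simp [log_im]; linarith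
  · simp [log_im]; linarith

theorem exp_branchLog_of_im_pos {u : ℂ} (hu : 0 < u.im) (s : ℂ) :
    exp ((s - 1) * branchLog u) = u ^ (s - 1) := by
  have hu0 : u ≠ 0 := by rintro rfl; simp at hu
  rw [log_eq_branchLog_of_im_pos hu, cpow_def_of_ne_zero hu0, mul_comm]

/-- Below the real axis the branch exceeds the principal logarithm by 2πi; as e^{-2πi} = 1, the
factor can be written with s instead of s - 1. -/
theorem exp_branchLog_of_im_neg {u : ℂ} (hu : u.im < 0) (s : ℂ) :
    exp ((s - 1) * branchLog u) = exp (2 * Real.pi * I * s) * u ^ (s - 1) := by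
  have hu0 : u ≠ 0 := by rintro rfl; simp at hu
  have h1 : exp (-(2 * Real.pi * I)) = 1 := by rw [Complex.exp_neg, exp_two_pi_mul_I, inv_one]
  rw [branchLog_of_im_neg hu, cpow_def_of_ne_zero hu0, ← Complex.exp_add,
    show (s - 1) * (log u + 2 * Real.pi * I) =
      (2 * Real.pi * I * s + log u * (s - 1)) + -(2 * Real.pi * I) by ring,
    Complex.exp_add _ (-(2 * Real.pi * I)), h1, mul_one]

namespace IsLoopKernel

variable {δ : ℝ} {K : ℂ → ℂ}

/-- The double pole leaves a bound by ‖u‖^{Re s - 3}. For Re s > 3 the value 0 given by 0 ^ (s - 1)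
= 0 is therefore the limit, and Cauchy's theorem applies to rectangles with a corner at the origin.
-/
theorem continuousAt_mul_cpow_zero (hK : IsLoopKernel δ K) {s : ℂ} (hs : 3 < s.re) :
    ContinuousAt (fun u => K u * u ^ (s - 1)) 0 := by
  obtain ⟨C, ε, hε, hC⟩ := hK.pole
  have hs1 : s - 1 ≠ 0 := fun h => by
    have := congrArg re h
    simp at this
    linarith
  rw [ContinuousAt, zero_cpow hs1, mul_zero]
  have hlim : Tendsto (fun u : ℂ => C * Real.exp (Real.pi * |s.im|) * ‖u‖ ^ (s.re - 3)) (𝓝 0)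
      (𝓝 0) := by
    have : ContinuousAt (fun u : ℂ => C * Real.exp (Real.pi * |s.im|) * ‖u‖ ^ (s.re - 3)) 0 :=
      continuousAt_const.mul (continuousAt_id.norm.rpow_const (Or.inr (by linarith)))
    have h2 := this.tendsto
    rwa [norm_zero, Real.zero_rpow (by linarith), mul_zero] at h2
  refine squeeze_zero_norm' ?_ hlim
  filter_upwards [Metric.ball_mem_nhds (0 : ℂ) hε] with u hu
  rcases eq_or_ne u 0 with rfl | hu0
  · rw [zero_cpow hs1, mul_zero, norm_zero, Real.zero_rpow (by linarith), mul_zero]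
  have hn : 0 < ‖u‖ := norm_pos_iff.mpr hu0
  have h1 := hC u (by simpa using hu)
  have h2 := norm_cpow_le' u (s - 1)
  rw [sub_re, one_re, sub_im, one_im, sub_zero] at h2
  rw [norm_mul]
  calc _ ≤ ‖K u‖ * (‖u‖ ^ (s.re - 1) * Real.exp (Real.pi * |s.im|)) := by gcongr
    _ = (‖K u‖ * ‖u‖ ^ (2 : ℝ)) * (‖u‖ ^ (s.re - 3) * Real.exp (Real.pi * |s.im|)) := by
      rw [show s.re - 1 = 2 + (s.re - 3) by ring, Real.rpow_add hn]; ring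
    _ ≤ C * (‖u‖ ^ (s.re - 3) * Real.exp (Real.pi * |s.im|)) := by gcongr
    _ = _ := by ring

theorem differentiableAt_mul_cpow (hK : IsLoopKernel δ K) (s : ℂ) {u : ℂ} (h0 : 0 ≤ u.re)
    (h1 : |u.im| ≤ δ) (hu : u ≠ 0) : DifferentiableAt ℂ (fun u => K u * u ^ (s - 1)) u := by
  refine (hK.differentiableAt u (Or.inr ⟨h0, h1⟩) hu).mul (differentiableAt_id.cpow_const ?_)
  rcases h0.lt_or_eq with h | h
  · exact Or.inl h
  · exact Or.inr fun him => hu (Complex.ext h.symm him)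

theorem continuousAt_mul_cpow (hK : IsLoopKernel δ K) {s : ℂ} (hs : 3 < s.re) {u : ℂ}
    (h0 : 0 ≤ u.re) (h1 : |u.im| ≤ δ) : ContinuousAt (fun u => K u * u ^ (s - 1)) u := by
  rcases eq_or_ne u 0 with rfl | hu
  · exact hK.continuousAt_mul_cpow_zero hs
  · exact (hK.differentiableAt_mul_cpow s h0 h1 hu).continuousAt

theorem exists_decay_mul_cpow (hK : IsLoopKernel δ K) (s : ℂ) : ∃ C b T : ℝ, 0 < b ∧
    ∀ t h : ℝ, T ≤ t → |h| ≤ δ →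
      ‖K (t + h * I) * (t + h * I) ^ (s - 1)‖ ≤ C * Real.exp (-b * t) := by
  obtain ⟨C, b, T, hb, hT⟩ := hK.exists_decay_mul_rpow (s.re - 1)
  refine ⟨C * Real.exp (Real.pi * |s.im|), b, T, hb, fun t h ht hh => ?_⟩
  have h2 := norm_cpow_le' (t + h * I) (s - 1)
  rw [sub_re, one_re, sub_im, one_im, sub_zero] at h2
  have h1 := hT t h ht hh
  rw [norm_mul]
  calc _ ≤ ‖K (t + h * I)‖ * (‖(t + h * I : ℂ)‖ ^ (s.re - 1) * Real.exp (Real.pi * |s.im|)) := by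
        gcongr
    _ = (‖K (t + h * I)‖ * ‖(t + h * I : ℂ)‖ ^ (s.re - 1)) * Real.exp (Real.pi * |s.im|) := by ring
    _ ≤ (C * Real.exp (-b * t)) * Real.exp (Real.pi * |s.im|) := by gcongr
    _ = _ := by ring

theorem integrableOn_mul_cpow (hK : IsLoopKernel δ K) {s : ℂ} (hs : 3 < s.re) {h : ℝ}
    (hh : |h| ≤ δ) :
    IntegrableOn (fun t : ℝ => K (t + h * I) * (t + h * I) ^ (s - 1)) (Ioi 0) := by
  obtain ⟨C, b, T, hb, hT⟩ := hK.exists_decay_mul_cpow s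
  have hc : ContinuousOn (fun t : ℝ => K (t + h * I) * (t + h * I) ^ (s - 1)) (Ici 0) :=
    fun t ht => ((hK.continuousAt_mul_cpow hs (u := t + h * I) (by simpa using ht)
      (by simpa using hh)).comp (f := fun t : ℝ => (t : ℂ) + h * I)
      (by fun_prop)).continuousWithinAt
  refine (integrable_norm_iff
    ((hc.mono Ioi_subset_Ici_self).aestronglyMeasurable measurableSet_Ioi)).mp ?_
  refine integrable_of_isBigO_exp_neg hb hc.norm (Asymptotics.IsBigO.of_bound C ?_)
  filter_upwards [eventually_ge_atTop T] with t ht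
  rw [norm_norm, Real.norm_of_nonneg (Real.exp_pos _).le]
  exact hT t h ht hh

/-- Shifting the half-line `[0, ∞)` vertically by `h`. -/
theorem integral_line_eq (hK : IsLoopKernel δ K) {s : ℂ} (hs : 3 < s.re) {h : ℝ} (hh : |h| ≤ δ) :
    ∫ t in Ioi (0 : ℝ), K (t + h * I) * (t + h * I) ^ (s - 1) =
      (∫ t in Ioi (0 : ℝ), K t * (t : ℂ) ^ (s - 1)) -
        I * ∫ y in (0 : ℝ)..h, K (y * I) * (y * I) ^ (s - 1) := by
  have habs : ∀ y ∈ uIcc 0 h, |y| ≤ δ := fun y hy => by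
    refine le_trans ?_ hh
    have := abs_sub_left_of_mem_uIcc hy
    simpa using this
  have hrect : ∀ R : ℝ, 0 ≤ R →
      (∫ x in (0 : ℝ)..R, K (x + (0 : ℝ) * I) * (x + (0 : ℝ) * I) ^ (s - 1)) -
      (∫ x in (0 : ℝ)..R, K (x + h * I) * (x + h * I) ^ (s - 1)) +
      I * (∫ y in (0 : ℝ)..h, K (R + y * I) * (R + y * I) ^ (s - 1)) -
      I * (∫ y in (0 : ℝ)..h, K (y * I) * (y * I) ^ (s - 1)) = 0 := by
    intro R hR
    have := integral_boundary_rect_eq_zero_of_continuousOn_of_differentiableOn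
      (fun u => K u * u ^ (s - 1)) 0 (R + h * I) ?_ ?_
    · simpa using this
    · intro u hu
      rw [mem_reProdIm] at hu
      simp only [zero_re, zero_im, add_re, ofReal_re, mul_re, I_re, mul_zero, ofReal_im, I_im,
        mul_one, sub_self, add_zero, add_im, mul_im, zero_add] at hu
      rw [uIcc_of_le hR] at hu
      exact (hK.continuousAt_mul_cpow hs hu.1.1 (habs _ hu.2)).continuousWithinAt
    · intro u hu
      rw [mem_reProdIm] at hu
      simp only [zero_re, zero_im, add_re, ofReal_re, mul_re, I_re, mul_zero, ofReal_im, I_im,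
        mul_one, sub_self, add_zero, add_im, mul_im, zero_add] at hu
      rw [min_eq_left hR] at hu
      refine (hK.differentiableAt_mul_cpow s hu.1.1.le (habs _ ?_) ?_).differentiableWithinAt
      · exact Ioo_subset_Icc_self hu.2
      · rintro rfl; simp at hu
  have hside : Tendsto (fun R : ℝ => ∫ y in (0 : ℝ)..h, K (R + y * I) * (R + y * I) ^ (s - 1))
      atTop (𝓝 0) := by
    obtain ⟨C, b, T, hb, hT⟩ := hK.exists_decay_mul_cpow s
    have hlim : Tendsto (fun R : ℝ => C * Real.exp (-b * R) * |h - 0|) atTop (𝓝 0) := by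
      have : Tendsto (fun R : ℝ => Real.exp (-b * R)) atTop (𝓝 0) :=
        Real.tendsto_exp_atBot.comp (tendsto_id.const_mul_atTop_of_neg (neg_lt_zero.mpr hb))
      simpa using (this.const_mul C).mul_const |h - 0|
    refine squeeze_zero_norm' ?_ hlim
    filter_upwards [eventually_ge_atTop T] with R hR
    exact intervalIntegral.norm_integral_le_of_norm_le_const fun y hy =>
      hT R y hR (habs y (uIoc_subset_uIcc hy))
  have h1 := intervalIntegral_tendsto_integral_Ioi 0
    (hK.integrableOn_mul_cpow hs (h := 0) (by simpa using hK.pos.le)) tendsto_id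
  have h2 := intervalIntegral_tendsto_integral_Ioi 0 (hK.integrableOn_mul_cpow hs hh) tendsto_id
  have h3 := (((h1.sub h2).add (hside.const_mul I)).sub_const
    (I * (∫ y in (0 : ℝ)..h, K (y * I) * (y * I) ^ (s - 1)))).congr' (f₂ := fun _ => 0) (by
      filter_upwards [eventually_ge_atTop 0] with R hR using hrect R hR)
  have h4 := tendsto_nhds_unique h3 tendsto_const_nhds
  simp only [ofReal_zero, zero_mul, add_zero, mul_zero] at h4
  linear_combination -h4

end IsLoopKernel

theorem log_exp_mul_I (x : ℝ) : log (Real.exp x * I) = x + Real.pi / 2 * I := by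
  rw [log_ofReal_mul (Real.exp_pos x) I_ne_zero, log_I, Real.log_exp]

theorem log_neg_exp_mul_I (x : ℝ) : log (-(Real.exp x * I)) = x - Real.pi / 2 * I := by
  rw [← mul_neg, log_ofReal_mul (Real.exp_pos x) (neg_ne_zero.mpr I_ne_zero), log_neg_I,
    Real.log_exp]
  ring

theorem exp_mul_eq_cpow_mul {u : ℂ} (hu : u ≠ 0) (s : ℂ) :
    exp (s * log u) = u ^ (s - 1) * u := by
  conv_rhs => rw [cpow_def_of_ne_zero hu]
  conv_rhs => rhs; rw [← exp_log hu]
  rw [← Complex.exp_add]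
  ring_nf

theorem tendsto_log_rpow_nhdsGT {a : ℝ} (ha : 0 < a) :
    Tendsto (fun r : ℝ => r ^ a) (𝓝[>] 0) (𝓝 0) := by
  have := (Real.continuousAt_rpow_const 0 a (Or.inr ha.le)).tendsto
  rw [Real.zero_rpow ha.ne'] at this
  exact this.mono_left nhdsWithin_le_nhds

namespace IsLoopKernel

variable {δ : ℝ} {K : ℂ → ℂ}

/-- This and `exp_lower` evaluate the integrand of `half_circle_sub` on the edges arg u = π/2 and
arg u = 3π/2. The second argument is 2π more than the principal one, whence e^{2πis}. -/
theorem exp_upper (s : ℂ) (x : ℝ) :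
    K (exp (x + (Real.pi / 2 : ℝ) * I)) * exp (s * (x + (Real.pi / 2 : ℝ) * I)) =
      Real.exp x • (I * (K (Real.exp x * I) * (Real.exp x * I) ^ (s - 1))) := by
  have h0 : (Real.exp x * I : ℂ) ≠ 0 := by simp
  have e : (x + (Real.pi / 2 : ℝ) * I : ℂ) = log (Real.exp x * I) := by
    rw [log_exp_mul_I]; push_cast; ring
  rw [e, exp_log h0, exp_mul_eq_cpow_mul h0, real_smul]
  ring

theorem exp_lower (s : ℂ) (x : ℝ) :
    K (exp (x + (3 * Real.pi / 2 : ℝ) * I)) * exp (s * (x + (3 * Real.pi / 2 : ℝ) * I)) =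
      Real.exp x • (-(I * exp (2 * Real.pi * I * s) *
        (K (-(Real.exp x * I)) * (-(Real.exp x * I)) ^ (s - 1)))) := by
  have h0 : -(Real.exp x * I : ℂ) ≠ 0 := by simp
  have e : (x + (3 * Real.pi / 2 : ℝ) * I : ℂ) = log (-(Real.exp x * I)) + 2 * Real.pi * I := by
    rw [log_neg_exp_mul_I]; push_cast; ring
  rw [e, Complex.exp_add, exp_log h0, exp_two_pi_mul_I, mul_one, mul_add, Complex.exp_add,
    exp_mul_eq_cpow_mul h0, real_smul, mul_comm s (2 * Real.pi * I)]
  ring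

theorem integral_exp_smul_comp {G : ℝ → ℂ} {r R : ℝ} (hr : 0 < r) (hrR : r ≤ R)
    (hG : ContinuousOn G (Icc r R)) :
    ∫ x in Real.log r..Real.log R, Real.exp x • G (Real.exp x) = ∫ y in r..R, G y := by
  have hR := hr.trans_le hrR
  have h := intervalIntegral.integral_deriv_smul_comp' (f := Real.exp) (f' := Real.exp) (g := G)
    (a := Real.log r) (b := Real.log R) (fun x _ => Real.hasDerivAt_exp x)
    Real.continuous_exp.continuousOn (hG.mono ?_)
  · simpa only [Function.comp, Real.exp_log hr, Real.exp_log hR] using h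
  · rintro _ ⟨x, hx, rfl⟩
    rw [uIcc_of_le (Real.log_le_log hr hrR)] at hx
    exact ⟨(Real.log_le_iff_le_exp hr).mp hx.1, (Real.le_log_iff_exp_le hR).mp hx.2⟩

theorem continuousOn_vertical (hK : IsLoopKernel δ K) {s : ℂ} (hs : 3 < s.re) :
    ContinuousOn (fun y : ℝ => K (y * I) * (y * I) ^ (s - 1)) (Icc 0 δ) ∧
    ContinuousOn (fun y : ℝ => K (-(y * I)) * (-(y * I)) ^ (s - 1)) (Icc 0 δ) := by
  constructor <;> intro y hy
  · refine ((hK.continuousAt_mul_cpow hs (u := y * I) (by simp) ?_).comp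
      (f := fun y : ℝ => (y * I : ℂ)) (by fun_prop)).continuousWithinAt
    simpa [abs_of_nonneg hy.1] using hy.2
  · refine ((hK.continuousAt_mul_cpow hs (u := -(y * I)) (by simp) ?_).comp
      (f := fun y : ℝ => (-(y * I) : ℂ)) (by fun_prop)).continuousWithinAt
    simpa [abs_of_nonneg hy.1] using hy.2

/-- Comparison of two half circles by Cauchy's theorem in logarithmic coordinates. -/
theorem half_circle_sub (hK : IsLoopKernel δ K) {s : ℂ} (hs : 3 < s.re) {r : ℝ} (hr : 0 < r)
    (hrδ : r ≤ δ) :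
    I * (∫ θ in (Real.pi / 2)..(3 * Real.pi / 2),
        K (exp (Real.log δ + θ * I)) * exp (s * (Real.log δ + θ * I))) -
      I * (∫ θ in (Real.pi / 2)..(3 * Real.pi / 2),
        K (exp (Real.log r + θ * I)) * exp (s * (Real.log r + θ * I))) =
    -(I * ∫ y in r..δ, K (y * I) * (y * I) ^ (s - 1)) -
      I * exp (2 * Real.pi * I * s) * ∫ y in r..δ, K (-(y * I)) * (-(y * I)) ^ (s - 1) := by
  -- In the coordinate ζ = log u the left half-annulus is the rectangle [log r, log δ] × [π/2,
  -- 3π/2], and the power becomes the entire function e^{sζ}.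
  have h := integral_boundary_rect_eq_zero_of_differentiableOn
    (fun ζ => K (exp ζ) * exp (s * ζ)) (Real.log r + (Real.pi / 2 : ℝ) * I)
    (Real.log δ + (3 * Real.pi / 2 : ℝ) * I) ?_
  · have hsub : Icc r δ ⊆ Icc 0 δ := Icc_subset_Icc_left hr.le
    simp only [add_re, ofReal_re, mul_re, I_re, mul_zero, ofReal_im, I_im, mul_one, sub_self,
        add_zero, add_im, mul_im, zero_add, smul_eq_mul, exp_upper, exp_lower] at h
    rw [integral_exp_smul_comp (G := fun y => I * (K (y * I) * (y * I) ^ (s - 1))) hr hrδ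
        (continuousOn_const.mul ((hK.continuousOn_vertical hs).1.mono hsub)),
      integral_exp_smul_comp (G := fun y => -(I * exp (2 * Real.pi * I * s) *
          (K (-(y * I)) * (-(y * I)) ^ (s - 1)))) hr hrδ
        (continuousOn_const.mul ((hK.continuousOn_vertical hs).2.mono hsub)).neg,
      intervalIntegral.integral_neg, intervalIntegral.integral_const_mul,
      intervalIntegral.integral_const_mul] at h
    linear_combination h
  · intro ζ hζ
    rw [mem_reProdIm] at hζ
    have h1 := hζ.1
    simp only [add_re, ofReal_re, mul_re, I_re, mul_zero, ofReal_im, I_im, mul_one, sub_self,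
        add_zero] at h1
    rw [uIcc_of_le (Real.log_le_log hr hrδ)] at h1
    have hmem : exp ζ ∈ loopRegion δ := by
      left
      rw [norm_exp]
      exact (Real.le_log_iff_exp_le hK.pos).mp h1.2
    refine DifferentiableAt.differentiableWithinAt ?_
    exact ((hK.differentiableAt _ hmem (Complex.exp_ne_zero ζ)).comp ζ differentiableAt_exp).mul
      (by fun_prop)

theorem tendsto_half_circle (hK : IsLoopKernel δ K) {s : ℂ} (hs : 3 < s.re) :
    Tendsto (fun r : ℝ => ∫ θ in (Real.pi / 2)..(3 * Real.pi / 2),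
      K (exp (Real.log r + θ * I)) * exp (s * (Real.log r + θ * I))) (𝓝[>] 0) (𝓝 0) := by
  obtain ⟨C, ε, hε, hC⟩ := hK.pole
  set M := Real.exp (2 * Real.pi * |s.im|) with hM
  have hlim : Tendsto (fun r : ℝ => C * M * r ^ (s.re - 2) *
      |3 * Real.pi / 2 - Real.pi / 2|) (𝓝[>] 0) (𝓝 0) := by
    simpa using ((tendsto_log_rpow_nhdsGT (by linarith : 0 < s.re - 2)).const_mul (C * M)).mul_const
      |3 * Real.pi / 2 - Real.pi / 2|
  refine squeeze_zero_norm' ?_ hlim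
  filter_upwards [Ioo_mem_nhdsGT hε] with r hr
  refine intervalIntegral.norm_integral_le_of_norm_le_const fun θ hθ => ?_
  replace hθ := uIoc_subset_uIcc hθ
  rw [uIcc_half_circle] at hθ
  have hn : ‖exp (Real.log r + θ * I)‖ = r := by
    rw [norm_exp]; simp [Real.exp_log hr.1]
  have h1 := hC (exp (Real.log r + θ * I)) (by rw [hn]; exact hr.2)
  rw [hn] at h1
  have h2 : ‖exp (s * (Real.log r + θ * I))‖ ≤ r ^ s.re * M := by
    rw [norm_exp, Real.rpow_def_of_pos hr.1, hM, ← Real.exp_add]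
    refine Real.exp_le_exp.mpr ?_
    have e : (s * (Real.log r + θ * I)).re = Real.log r * s.re + -s.im * θ := by
      simp; ring
    rw [e]
    have hp := Real.pi_pos
    have h3 : -s.im * θ ≤ |s.im| * (2 * Real.pi) := by
      refine mul_le_mul (neg_le_abs _) (by linarith [hθ.2]) (by linarith [hθ.1]) (abs_nonneg _)
    linarith
  rw [norm_mul]
  calc _ ≤ ‖K (exp (Real.log r + θ * I))‖ * (r ^ s.re * M) := by gcongr
    _ = (‖K (exp (Real.log r + θ * I))‖ * r ^ (2 : ℝ)) * (r ^ (s.re - 2) * M) := by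
      rw [show s.re = 2 + (s.re - 2) by ring, Real.rpow_add hr.1]; ring_nf
    _ ≤ C * (r ^ (s.re - 2) * M) := by
      have := Real.rpow_nonneg hr.1.le (s.re - 2)
      gcongr
    _ = _ := by ring

theorem half_circle_eq (hK : IsLoopKernel δ K) {s : ℂ} (hs : 3 < s.re) :
    I * (∫ θ in (Real.pi / 2)..(3 * Real.pi / 2),
        K (exp (Real.log δ + θ * I)) * exp (s * (Real.log δ + θ * I))) =
    -(I * ∫ y in (0 : ℝ)..δ, K (y * I) * (y * I) ^ (s - 1)) -
      I * exp (2 * Real.pi * I * s) * ∫ y in (0 : ℝ)..δ, K (-(y * I)) * (-(y * I)) ^ (s - 1) := by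
  have hprim : ∀ G : ℝ → ℂ, ContinuousOn G (Icc 0 δ) →
      Tendsto (fun r => ∫ y in r..δ, G y) (𝓝[>] 0) (𝓝 (∫ y in (0 : ℝ)..δ, G y)) := by
    intro G hG
    have h1 := intervalIntegral.continuousOn_primitive_interval_left (μ := volume) (a := 0) (b := δ)
      (f := G) (by rw [uIcc_of_le hK.pos.le]; exact hG.integrableOn_Icc)
    rw [uIcc_of_le hK.pos.le] at h1
    have h2 := (h1 0 (left_mem_Icc.mpr hK.pos.le)).tendsto
    refine h2.mono_left ?_
    rw [← nhdsWithin_Ioo_eq_nhdsGT hK.pos]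
    exact nhdsWithin_mono _ Ioo_subset_Icc_self
  have hL := ((hK.tendsto_half_circle hs).const_mul I).const_sub (I *
    (∫ θ in (Real.pi / 2)..(3 * Real.pi / 2),
        K (exp (Real.log δ + θ * I)) * exp (s * (Real.log δ + θ * I))))
  have hR := ((hprim _ (hK.continuousOn_vertical hs).1).const_mul I).neg.sub
    ((hprim _ (hK.continuousOn_vertical hs).2).const_mul (I * exp (2 * Real.pi * I * s)))
  rw [mul_zero, sub_zero] at hL
  refine tendsto_nhds_unique (hL.congr' ?_) hR
  filter_upwards [Ioo_mem_nhdsGT hK.pos] with r hr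
  exact hK.half_circle_sub hs hr.1 hr.2.le

/-- For `Re s > 3` the loop can be collapsed onto the half-line `[0, ∞)`. -/
theorem loopIntegral_eq (hK : IsLoopKernel δ K) {s : ℂ} (hs : 3 < s.re) :
    loopIntegral δ (fun u => K u * exp ((s - 1) * branchLog u)) =
      (exp (2 * Real.pi * I * s) - 1) * ∫ t in Ioi (0 : ℝ), K t * (t : ℂ) ^ (s - 1) := by
  have hδ := hK.pos
  have h1 : ∫ t in Ioi (0 : ℝ), K (t + δ * I) * exp ((s - 1) * branchLog (t + δ * I)) =
      ∫ t in Ioi (0 : ℝ), K (t + δ * I) * (t + δ * I) ^ (s - 1) := by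
    refine setIntegral_congr_fun measurableSet_Ioi fun t _ => ?_
    rw [exp_branchLog_of_im_pos (by simpa using hδ)]
  have h2 : ∫ t in Ioi (0 : ℝ), K (t - δ * I) * exp ((s - 1) * branchLog (t - δ * I)) =
      exp (2 * Real.pi * I * s) *
        ∫ t in Ioi (0 : ℝ), K (t + (-δ : ℝ) * I) * (t + (-δ : ℝ) * I) ^ (s - 1) := by
    rw [← integral_const_mul]
    refine setIntegral_congr_fun measurableSet_Ioi fun t _ => ?_
    rw [line_neg, exp_branchLog_of_im_neg (by simpa using hδ)]
    ring
  have h3 : ∫ y in (0 : ℝ)..-δ, K (y * I) * (y * I) ^ (s - 1) =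
      -∫ y in (0 : ℝ)..δ, K (-(y * I)) * (-(y * I)) ^ (s - 1) := by
    have := intervalIntegral.integral_comp_neg (a := 0) (b := δ)
      fun y : ℝ => K (y * I) * (y * I) ^ (s - 1)
    simp only [ofReal_neg, neg_mul, neg_zero] at this
    rw [this, intervalIntegral.integral_symm]
  have h4 : ∀ θ : ℝ, (δ * exp (θ * I) : ℂ) = exp (Real.log δ + θ * I) := fun θ => by
    rw [Complex.exp_add, ← ofReal_exp, Real.exp_log hδ]
  rw [loopIntegral, h1, h2, hK.integral_line_eq hs hK.abs_width_le,
    hK.integral_line_eq hs hK.abs_neg_width_le, h3,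
    intervalIntegral.integral_congr (circle_integrand_congr hδ s),
    intervalIntegral.integral_const_mul]
  simp only [h4]
  -- The segments [0, ±iδ] left by shifting the two lines cancel against those left by the half
  -- circle.
  rw [hK.half_circle_eq hs]
  ring

end IsLoopKernel

/-! ### The kernel of f and its Mellin transform. -/

/-- The meromorphic part of the integrand of `f`. -/
noncomputable def kernel (k : ℕ) (w : ℂ) (x y : ℝ) (u : ℂ) : ℂ :=
  exp (-(x * w * u)) / (exp (-w * k * u) - 1) * (exp (y * u) / (exp (k * u) - 1))

theorem tendsto_div_exp_sub_one {a : ℂ} (ha : a ≠ 0) :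
    Tendsto (fun u => u / (exp (a * u) - 1)) (𝓝[≠] 0) (𝓝 a⁻¹) := by
  have h : HasDerivAt (fun u => exp (a * u)) a 0 := by
    simpa using ((hasDerivAt_id (0 : ℂ)).const_mul a).cexp
  have h2 := (hasDerivAt_iff_tendsto_slope.mp h).inv₀ ha
  refine h2.congr fun u => ?_
  simp [slope_def_field]

theorem norm_inv_sub_one_le {v : ℂ} (hv : ‖v‖ ≤ 1 / 2) : ‖(v - 1)⁻¹‖ ≤ 2 := by
  have h : 1 / 2 ≤ ‖v - 1‖ := by
    have := norm_sub_norm_le (1 : ℂ) v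
    rw [norm_one, norm_sub_rev] at this
    linarith
  rw [norm_inv, inv_le_comm₀ (by linarith) two_pos]
  linarith

section Kernel

variable {k : ℕ} {w : ℂ} {x y δ : ℝ}

theorem kernel_decay (hk : 0 < k) (hw : 0 < w.re) (hx : 0 < x) (hy : y < k) (δ : ℝ) :
    ∃ C b T : ℝ, 0 < b ∧ ∀ u : ℂ, T ≤ u.re → |u.im| ≤ δ →
      ‖kernel k w x y u‖ ≤ C * Real.exp (-b * u.re) := by
  have hk' : (0 : ℝ) < k := by exact_mod_cast hk
  -- The 4 is 2 · 2, one factor 2 for each denominator: T makes Re(ku) and Re(kwu) at least 1, so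
  -- both decaying exponentials are at most e^{-1} ≤ 1/2. The rate comes from e^{-xwu} alone; y < k
  -- keeps the other quotient bounded.
  refine ⟨4 * Real.exp (x * (|w.im| * δ)), x * w.re,
    max (1 / k) ((1 / k + |w.im| * δ) / w.re), by positivity, fun u hu him => ?_⟩
  rw [max_le_iff, div_le_iff₀ hw, div_le_iff₀ hk'] at hu
  have hwim : w.im * u.im ≤ |w.im| * δ := by
    calc _ ≤ |w.im * u.im| := le_abs_self _
      _ = |w.im| * |u.im| := abs_mul _ _
      _ ≤ _ := by gcongr
  have hwu : (w * u).re = w.re * u.re - w.im * u.im := mul_re _ _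
  have hre : 1 / k ≤ (w * u).re := by rw [hwu]; linarith [hu.2]
  have hu1 : 0 < u.re := by
    have := div_pos one_pos hk'
    by_contra! h
    nlinarith [hu.1]
  have hhalf : Real.exp (-1) ≤ 1 / 2 := by
    have h2 := Real.add_one_le_exp (1 : ℝ)
    rw [Real.exp_neg, inv_le_comm₀ (Real.exp_pos _) (by norm_num)]
    norm_num
    linarith
  have h1 : ‖exp (-w * k * u)‖ ≤ 1 / 2 := by
    rw [norm_exp]
    refine (Real.exp_le_exp.mpr ?_).trans hhalf
    have e : (-w * k * u).re = -(k * (w * u).re) := by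
      rw [show -w * k * u = ((-k : ℝ) : ℂ) * (w * u) by push_cast; ring, re_ofReal_mul]; ring
    rw [e]
    rw [div_le_iff₀ hk'] at hre
    linarith
  have h2 : ‖exp (-(k * u))‖ ≤ 1 / 2 := by
    rw [norm_exp]
    refine (Real.exp_le_exp.mpr ?_).trans hhalf
    have e : (-(k * u)).re = -(u.re * k) := by simp; ring
    rw [e]
    linarith [hu.1]
  have h3 : exp (y * u) / (exp (k * u) - 1) =
      -(exp ((y - k) * u) * (exp (-(k * u)) - 1)⁻¹) := by
    have e : exp (k * u) - 1 = -(exp (k * u) * (exp (-(k * u)) - 1)) := by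
      rw [mul_sub, ← Complex.exp_add, add_neg_cancel, Complex.exp_zero]; ring
    rw [e, div_neg, div_eq_mul_inv, mul_inv, ← Complex.exp_neg, ← mul_assoc, ← Complex.exp_add]
    ring_nf
  have h4 : ‖exp ((y - k) * u)‖ ≤ 1 := by
    rw [norm_exp, Real.exp_le_one_iff]
    have e : ((y - k) * u : ℂ).re = (y - k) * u.re := by simp
    rw [e]
    nlinarith
  have h5 : ‖exp (-(x * w * u))‖ ≤ Real.exp (x * (|w.im| * δ)) * Real.exp (-(x * w.re) * u.re) := by
    rw [norm_exp, ← Real.exp_add]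
    refine Real.exp_le_exp.mpr ?_
    have e : (-(x * w * u)).re = -(x * (w * u).re) := by
      rw [show -(x * w * u) = ((-x : ℝ) : ℂ) * (w * u) by push_cast; ring, re_ofReal_mul]; ring
    rw [e, hwu]
    nlinarith
  rw [kernel, h3, norm_mul, div_eq_mul_inv, norm_mul, norm_neg, norm_mul]
  calc _ ≤ (Real.exp (x * (|w.im| * δ)) * Real.exp (-(x * w.re) * u.re)) * 2 * (1 * 2) := by
        gcongr
        · exact norm_inv_sub_one_le h1
        · exact norm_inv_sub_one_le h2
    _ = _ := by ring

theorem isLoopKernel_kernel (hk : 0 < k) (hw : 0 < w.re) (hx : 0 < x) (hy : y < k)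
    (hδ : IsLoopWidth k w δ) : IsLoopKernel δ (kernel k w x y) where
  pos := hδ.1
  differentiableAt u hu hu0 := by
    have h := mt (hδ.2 u hu) hu0
    obtain ⟨h1, h2⟩ := mul_ne_zero_iff.mp h
    unfold kernel
    have hd : ∀ a : ℂ, DifferentiableAt ℂ (fun u => exp (a * u) - 1) u := fun a => by fun_prop
    exact (DifferentiableAt.div (by fun_prop) (hd _) h1).mul
      (DifferentiableAt.div (by fun_prop) (hd _) h2)
  pole := by
    have hk0 : (k : ℂ) ≠ 0 := by exact_mod_cast hk.ne'
    have hw0 : w ≠ 0 := by rintro rfl; simp at hw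
    have hc : Tendsto (fun u : ℂ => exp (-(x * w * u)) * exp (y * u)) (𝓝[≠] 0)
        (𝓝 (exp (-(x * w * 0)) * exp (y * 0))) :=
      ((Continuous.tendsto (by fun_prop) 0).mono_left nhdsWithin_le_nhds)
    have h := (hc.mul ((tendsto_div_exp_sub_one (a := -w * k) (by simp [hk0, hw0])).mul
      (tendsto_div_exp_sub_one hk0))).norm
    set B := ‖exp (-(x * w * 0)) * exp (y * 0) * ((-w * k)⁻¹ * (k : ℂ)⁻¹)‖
    have h2 := h.eventually_le_const (lt_add_one B)
    rw [eventually_nhdsWithin_iff, Metric.eventually_nhds_iff] at h2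
    obtain ⟨ε, hε, h3⟩ := h2
    refine ⟨B + 1, ε, hε, fun u hu => ?_⟩
    rcases eq_or_ne u 0 with rfl | hu0
    · rw [norm_zero, Real.zero_rpow two_ne_zero, mul_zero]
      positivity
    · refine le_trans (le_of_eq ?_) (h3 (by simpa using hu) hu0)
      rw [Real.rpow_two, ← norm_pow, ← norm_mul, kernel]
      congr 1
      ring
  decay := kernel_decay hk hw hx hy δ

/-- The exponents in the expansion of `kernel` into a double geometric series. -/
noncomputable def kernelExponent (k : ℕ) (w : ℂ) (x y : ℝ) (p : ℕ × ℕ) : ℂ :=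
  (x + p.1 * k) * w + ((p.2 + 1) * k - y)

theorem kernelExponent_re_ge (hw : 0 < w.re) (hy0 : 0 ≤ y)
    (p : ℕ × ℕ) : (min x k * w.re) * ((p.1 : ℝ) + 1) + (k - y) * ((p.2 : ℝ) + 1) ≤
      (kernelExponent k w x y p).re := by
  have e : (kernelExponent k w x y p).re = (x + p.1 * k) * w.re + ((p.2 + 1) * k - y) := by
    simp [kernelExponent]
  have h1 : min x k * ((p.1 : ℝ) + 1) ≤ x + p.1 * k := by
    have h2 := min_le_left x (k : ℝ)
    have h3 := min_le_right x (k : ℝ)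
    nlinarith [Nat.cast_nonneg (α := ℝ) p.1]
  rw [e]
  have h4 := mul_le_mul_of_nonneg_right h1 hw.le
  nlinarith [mul_nonneg hy0 (Nat.cast_nonneg (α := ℝ) p.2)]

theorem kernelExponent_re_pos (hk : 0 < k) (hw : 0 < w.re) (hx : 0 < x) (hy0 : 0 ≤ y) (hy : y < k)
    (p : ℕ × ℕ) : 0 < (kernelExponent k w x y p).re := by
  have hk' : (0 : ℝ) < k := by exact_mod_cast hk
  refine lt_of_lt_of_le ?_ (kernelExponent_re_ge (k := k) (x := x) hw hy0 p)
  have : 0 < min x (k : ℝ) := lt_min hx hk'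
  have : 0 < (k : ℝ) - y := by linarith
  positivity

/-- Since (u + v)² ≥ uv, the real part is at least the square root of αβ(p+1)(q+1); the double
series is dominated by a product of two series of exponent σ/2 > 1. -/
theorem summable_kernelExponent_rpow (hk : 0 < k) (hw : 0 < w.re) (hx : 0 < x) (hy0 : 0 ≤ y)
    (hy : y < k) {σ : ℝ} (hσ : 2 < σ) :
    Summable fun p : ℕ × ℕ => (kernelExponent k w x y p).re ^ (-σ) := by
  have hk' : (0 : ℝ) < k := by exact_mod_cast hk
  have hα : 0 < min x (k : ℝ) * w.re := mul_pos (lt_min hx hk') hw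
  have hβ : 0 < (k : ℝ) - y := by linarith
  have h1 : Summable fun n : ℕ => ((n : ℝ) + 1) ^ (-(σ / 2)) := by
    have := (summable_nat_add_iff 1).mpr (Real.summable_nat_rpow.mpr (by linarith : -(σ / 2) < -1))
    simpa using this
  have h2 := (h1.mul_of_nonneg h1 (fun _ => by positivity) (fun _ => by positivity)).mul_left
    ((min x (k : ℝ) * w.re * (k - y)) ^ (-(σ / 2)))
  refine Summable.of_nonneg_of_le (fun p => Real.rpow_nonneg
    (kernelExponent_re_pos hk hw hx hy0 hy p).le _) (fun p => ?_) h2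
  have h3 := kernelExponent_re_ge (k := k) (x := x) hw hy0 p
  have hpos := kernelExponent_re_pos hk hw hx hy0 hy p
  set α := min x (k : ℝ) * w.re
  set β := (k : ℝ) - y
  set ρ := (kernelExponent k w x y p).re
  have h4 : α * β * (((p.1 : ℝ) + 1) * ((p.2 : ℝ) + 1)) ≤ ρ ^ (2 : ℝ) := by
    have ha : 0 < α * ((p.1 : ℝ) + 1) := by positivity
    have hb : 0 < β * ((p.2 : ℝ) + 1) := by positivity
    have := pow_le_pow_left₀ (by positivity) h3 2
    rw [Real.rpow_two]
    nlinarith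
  calc ρ ^ (-σ) = (ρ ^ (2 : ℝ)) ^ (-(σ / 2)) := by rw [← Real.rpow_mul hpos.le]; ring_nf
    _ ≤ (α * β * (((p.1 : ℝ) + 1) * ((p.2 : ℝ) + 1))) ^ (-(σ / 2)) :=
        Real.rpow_le_rpow_of_nonpos (by positivity) h4 (by linarith)
    _ = _ := by rw [Real.mul_rpow (by positivity) (by positivity),
        Real.mul_rpow (x := (p.1 : ℝ) + 1) (by positivity) (by positivity)]

/-- The sign comes from 1/(e^{-wkt} - 1) = -∑ e^{-pwkt}; the other factor is ∑ e^{(y-(q+1)k)t}. -/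
theorem kernel_eq_tsum (hk : 0 < k) (hw : 0 < w.re) {t : ℝ} (ht : 0 < t) :
    kernel k w x y t = -∑' p : ℕ × ℕ, exp (-(kernelExponent k w x y p * t)) := by
  have hk' : (0 : ℝ) < k := by exact_mod_cast hk
  have h1 : ‖exp (-w * k * t)‖ < 1 := by
    rw [norm_exp, Real.exp_lt_one_iff]
    have e : (-w * k * t).re = -(w.re * k * t) := by simp
    rw [e, neg_lt_zero]
    positivity
  have h2 : ‖exp (-(k * t))‖ < 1 := by
    rw [norm_exp, Real.exp_lt_one_iff]
    have e : (-(k * t) : ℂ).re = -(k * t) := by simp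
    rw [e, neg_lt_zero]
    positivity
  have hs1 := (summable_norm_geometric_of_norm_lt_one h1).mul_left ‖exp (-(x * w * t))‖
  have hs2 := (summable_norm_geometric_of_norm_lt_one h2).mul_left ‖exp ((y - k) * t)‖
  simp only [← norm_mul] at hs1 hs2
  have h3 := tsum_mul_tsum_of_summable_norm hs1 hs2
  rw [tsum_mul_left, tsum_mul_left, tsum_geometric_of_norm_lt_one h1,
    tsum_geometric_of_norm_lt_one h2] at h3
  have h4 : ∀ p : ℕ × ℕ, exp (-(kernelExponent k w x y p * t)) =
      exp (-(x * w * t)) * exp (-w * k * t) ^ p.1 * (exp ((y - k) * t) * exp (-(k * t)) ^ p.2) := by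
    intro p
    rw [← Complex.exp_nat_mul, ← Complex.exp_nat_mul, ← Complex.exp_add, ← Complex.exp_add,
      ← Complex.exp_add, kernelExponent]
    congr 1
    ring
  simp only [h4]
  rw [← h3, kernel]
  have h5 : exp (y * t) / (exp (k * t) - 1) = exp ((y - k) * t) * (1 - exp (-(k * t)))⁻¹ := by
    have e : exp (k * t) - 1 = exp (k * t) * (1 - exp (-(k * t))) := by
      rw [mul_sub, ← Complex.exp_add, add_neg_cancel, Complex.exp_zero]; ring
    rw [e, div_eq_mul_inv, mul_inv, ← Complex.exp_neg, ← mul_assoc, ← Complex.exp_add]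
    ring_nf
  rw [h5, ← neg_sub (1 : ℂ), div_neg, div_eq_mul_inv]
  ring

/-- Termwise Gamma integrals; the interchange is allowed because the integrals of the norms, Γ(Re
s)(Re r)^{-Re s} with r the exponent, are summable for Re s > 2. -/
theorem integral_kernel_mul_cpow (hk : 0 < k) (hw : 0 < w.re) (hx : 0 < x) (hy0 : 0 ≤ y)
    (hy : y < k) {s : ℂ} (hs : 2 < s.re) :
    ∫ t in Ioi (0 : ℝ), kernel k w x y t * (t : ℂ) ^ (s - 1) =
      -(Gamma s * ∑' p : ℕ × ℕ, kernelExponent k w x y p ^ (-s)) := by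
  have hs0 : 0 < s.re := by linarith
  have hre := kernelExponent_re_pos hk hw hx hy0 hy
  have h := hasSum_integral_of_summable_integral_norm (μ := volume.restrict (Ioi (0 : ℝ)))
    (F := fun (p : ℕ × ℕ) (t : ℝ) => (t : ℂ) ^ (s - 1) * exp (-(kernelExponent k w x y p * t)))
    (fun p => integrableOn_cpow_mul_exp hs0 (hre p)) ?_
  · simp only [integral_cpow_mul_exp_Ioi hs0 (hre _)] at h
    rw [← tsum_mul_left, ← neg_eq_iff_eq_neg, ← integral_neg, tsum_congr fun p => mul_comm _ _,
      h.tsum_eq]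
    refine setIntegral_congr_fun measurableSet_Ioi fun t ht => ?_
    rw [kernel_eq_tsum hk hw ht, tsum_mul_left]
    ring
  · have h2 : ∀ p : ℕ × ℕ, ∫ t in Ioi (0 : ℝ),
        ‖(t : ℂ) ^ (s - 1) * exp (-(kernelExponent k w x y p * t))‖ =
        (kernelExponent k w x y p).re ^ (-s.re) * Real.Gamma s.re := by
      intro p
      rw [setIntegral_congr_fun measurableSet_Ioi fun t ht => norm_cpow_mul_exp ht,
        Real.integral_rpow_mul_exp_neg_mul_Ioi hs0 (hre p), one_div, Real.inv_rpow (hre p).le,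
        Real.rpow_neg (hre p).le]
    simp only [h2]
    exact (summable_kernelExponent_rpow hk hw hx hy0 hy hs).mul_right _

end Kernel

/-! ### Parametrization of the cone. -/

theorem eq_of_mul_add_eq {c A A' j j' : ℤ} (hj : 1 ≤ j ∧ j ≤ c) (hj' : 1 ≤ j' ∧ j' ≤ c)
    (h : A * c + j = A' * c + j') : A = A' ∧ j = j' := by
  have hc : 0 < c := by linarith [hj.1, hj.2]
  have hA : A = A' := by
    rcases lt_trichotomy A A' with h1 | h1 | h1
    · nlinarith [mul_le_mul_of_nonneg_right (Int.add_one_le_iff.mpr h1) hc.le]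
    · exact h1
    · nlinarith [mul_le_mul_of_nonneg_right (Int.add_one_le_iff.mpr h1) hc.le]
  subst hA
  exact ⟨rfl, by linarith⟩

/-- Division of m - 1 by c, so that remainders run over 1, …, c like the index j. -/
theorem exists_eq_mul_add {c m : ℤ} (hc : 0 < c) (hm : 0 < m) :
    ∃ (A : ℕ) (j : ℤ), 1 ≤ j ∧ j ≤ c ∧ m = A * c + j := by
  have h1 := Int.emod_nonneg (m - 1) hc.ne'
  have h2 := Int.emod_lt_of_pos (m - 1) hc
  have h3 := Int.mul_ediv_add_emod (m - 1) c
  have h4 : 0 ≤ (m - 1) / c := Int.ediv_nonneg (by omega) hc.le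
  refine ⟨((m - 1) / c).toNat, (m - 1) % c + 1, by omega, by omega, ?_⟩
  rw [Int.toNat_of_nonneg h4]
  linarith

theorem floor_div_bounds {c : ℤ} (hc : 0 < c) (d j : ℤ) :
    ⌊(d : ℝ) * j / c⌋ * c ≤ d * j ∧ d * j < (⌊(d : ℝ) * j / c⌋ + 1) * c := by
  have hc' : (0 : ℝ) < c := by exact_mod_cast hc
  have h1 := Int.floor_le ((d : ℝ) * j / c)
  have h2 := Int.lt_floor_add_one ((d : ℝ) * j / c)
  rw [le_div_iff₀ hc'] at h1
  rw [div_lt_iff₀ hc'] at h2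
  exact ⟨by exact_mod_cast h1, by exact_mod_cast h2⟩

/-- The parametrization of the lattice points of the cone `M > 0`, `c N > d M`. -/
noncomputable def coneMap (k : ℕ) (c d : ℤ)
    (t : (Finset.Icc 1 c × Fin k × Fin k) × (ℕ × ℕ)) : ℤ × ℤ :=
  (((t.1.2.1 : ℕ) + t.2.1 * k) * c + t.1.1,
    d * ((t.1.2.1 : ℕ) + t.2.1 * k) + ⌊(d : ℝ) * (t.1.1 : ℤ) / c⌋ +
      ((t.2.2 + 1) * k - (t.1.2.2 : ℕ)))

theorem coneMap_injective (k : ℕ) (c d : ℤ) : Function.Injective (coneMap k c d) := by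
  rintro ⟨⟨⟨j, hj⟩, μ, ν⟩, p, q⟩ ⟨⟨⟨j', hj'⟩, μ', ν'⟩, p', q'⟩ h
  simp only [coneMap, Prod.mk.injEq] at h
  obtain ⟨h1, h2⟩ := h
  obtain ⟨hA, rfl⟩ := eq_of_mul_add_eq (Finset.mem_Icc.mp hj) (Finset.mem_Icc.mp hj') h1
  have hμ := μ.isLt
  have hμ' := μ'.isLt
  have hν := ν.isLt
  have hν' := ν'.isLt
  -- Remainders must lie in 1, …, k: hence μ + 1 here, and k - ν below, from (q+1)k - ν = qk + (k -
  -- ν).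
  have hB := eq_of_mul_add_eq (c := k) (A := p) (A' := p') (j := (μ : ℕ) + 1)
    (j' := (μ' : ℕ) + 1) (by omega) (by omega) (by linarith)
  rw [hA] at h2
  have hC := eq_of_mul_add_eq (c := k) (A := q) (A' := q') (j := k - (ν : ℕ))
    (j' := k - (ν' : ℕ)) (by omega) (by omega) (by linarith)
  have e1 : p = p' := by exact_mod_cast hB.1
  have e2 : q = q' := by exact_mod_cast hC.1
  have e3 : μ = μ' := Fin.ext (by omega)
  have e4 : ν = ν' := Fin.ext (by omega)
  subst e1 e2 e3 e4
  rfl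

/-- Write M = Ac + j with A ≥ 0 and 1 ≤ j ≤ c. Then cN > dM means N - dA > dj/c, that is, L = N - dA
- ⌊dj/c⌋ ≥ 1. Here μ and ν are the residues of A and -L modulo k. -/
theorem range_coneMap {k : ℕ} (hk : 0 < k) {c : ℤ} (hc : 0 < c) (d : ℤ) :
    range (coneMap k c d) = {p : ℤ × ℤ | 0 < p.1 ∧ d * p.1 < c * p.2} := by
  have hkz : (0 : ℤ) < k := by exact_mod_cast hk
  ext ⟨M, N⟩
  constructor
  · rintro ⟨⟨⟨⟨j, hj⟩, μ, ν⟩, p, q⟩, h⟩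
    simp only [coneMap, Prod.mk.injEq] at h
    obtain ⟨rfl, rfl⟩ := h
    have hj' := Finset.mem_Icc.mp hj
    have hν : ((ν : ℕ) : ℤ) + 1 ≤ k := by have := ν.isLt; omega
    obtain ⟨-, hF⟩ := floor_div_bounds hc d j
    have hq : (0 : ℤ) ≤ q * k := by positivity
    refine ⟨by have : (0 : ℤ) ≤ ((μ : ℕ) + p * k) * c := by positivity
               linarith [hj'.1], ?_⟩
    have h1 : c * 1 ≤ c * ((q + 1) * k - ((ν : ℕ) : ℤ)) :=
      mul_le_mul_of_nonneg_left (by linarith) hc.le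
    nlinarith
  · rintro ⟨hM, hN⟩
    simp only at hM hN
    obtain ⟨A, j, hj1, hj2, rfl⟩ := exists_eq_mul_add hc hM
    obtain ⟨hF, -⟩ := floor_div_bounds hc d j
    set F := ⌊(d : ℝ) * j / c⌋ with hFdef
    have hL : 0 < N - d * A - F := by
      have : 0 < c * (N - d * A - F) := by nlinarith
      exact pos_of_mul_pos_right this hc.le
    obtain ⟨q, l, hl1, hl2, hql⟩ := exists_eq_mul_add hkz hL
    refine ⟨((⟨j, Finset.mem_Icc.mpr ⟨hj1, hj2⟩⟩, ⟨A % k, Nat.mod_lt _ hk⟩,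
      ⟨(k - l).toNat, by omega⟩), (A / k, q)), ?_⟩
    have hA : ((A % k : ℕ) : ℤ) + (A / k : ℕ) * k = A := by
      exact_mod_cast Nat.mod_add_div' A k
    have hl : (((k - l).toNat : ℕ) : ℤ) = k - l := Int.toNat_of_nonneg (by omega)
    simp only [coneMap, Prod.mk.injEq]
    rw [hA, hl]
    exact ⟨rfl, by rw [← hFdef]; linarith⟩

section Cone

variable {k : ℕ} (ψ : DirichletCharacter ℂ k)

/-- With A = μ + pk and L = (q+1)k - ν one has Mz + N = (A + j/c)(cz+d) + L - {dj/c}, while the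
characters see only j, μ, ν. -/
theorem latticeTerm_coneMap {c : ℤ} (hc : 0 < c) (d : ℤ) (s z : ℂ) (j : Finset.Icc 1 c)
    (μ ν : Fin k) (p : ℕ × ℕ) :
    latticeTerm ψ s z (coneMap k c d ((j, μ, ν), p)) =
      ψ (((μ : ℕ) * c + j : ℤ) : ZMod k) *
      star ψ ((⌊(d : ℝ) * (j : ℤ) / c⌋ + d * (μ : ℕ) - (ν : ℕ) : ℤ) : ZMod k) *
      kernelExponent k ((c : ℂ) * z + d) ((((μ : ℕ) : ℝ) * c + (j : ℤ)) / c)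
        ((ν : ℕ) + Int.fract ((d : ℝ) * (j : ℤ) / c)) p ^ (-s) := by
  have hc' : (c : ℂ) ≠ 0 := by exact_mod_cast hc.ne'
  simp only [latticeTerm, coneMap, kernelExponent]
  congr 1
  · congr 1
    · congr 1
      push_cast
      simp
    · congr 1
      push_cast
      simp
      ring
  · congr 1
    rw [Int.fract]
    push_cast
    field_simp
    ring

theorem sum_tsum_kernelExponent [NeZero k] {c : ℤ} (hc : 0 < c) (d : ℤ) {s z : ℂ} (hs : 2 < s.re)
    (hz : 0 < z.im) :
    ∑ j ∈ Finset.Icc 1 c, ∑ μ ∈ Finset.range k, ∑ ν ∈ Finset.range k,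
      ψ (((μ : ℤ) * c + j : ℤ) : ZMod k) *
      star ψ ((⌊(d : ℝ) * j / c⌋ + d * (μ : ℤ) - (ν : ℤ) : ℤ) : ZMod k) *
      ∑' p : ℕ × ℕ, kernelExponent k ((c : ℂ) * z + d) (((μ : ℝ) * c + j) / c)
        (ν + Int.fract ((d : ℝ) * j / c)) p ^ (-s) = coneSum ψ s z c d := by
  have hsum := summable_latticeTerm ψ hs hz
  have h1 : coneSum ψ s z c d = ∑' t, latticeTerm ψ s z (coneMap k c d t) := by
    rw [coneSum, ← range_coneMap (NeZero.pos k) hc d, ← tsum_subtype,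
      tsum_range _ (coneMap_injective k c d)]
  have h2 := Summable.tsum_prod (hsum.comp_injective (coneMap_injective k c d))
  simp only [Function.comp_apply] at h2
  rw [h1, h2, tsum_fintype, Fintype.sum_prod_type, ← Finset.sum_coe_sort (Finset.Icc 1 c)]
  refine Finset.sum_congr rfl fun j _ => ?_
  rw [Fintype.sum_prod_type, Finset.sum_range]
  refine Finset.sum_congr rfl fun μ _ => ?_
  rw [Finset.sum_range]
  refine Finset.sum_congr rfl fun ν _ => ?_
  simp only [latticeTerm_coneMap ψ hc, tsum_mul_left]

end Cone

/-! ### Reduction of A₁ and B to A. -/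

section Halving

variable {k : ℕ} (χ : DirichletCharacter ℂ k)

theorem A₁Term_eq (s z : ℂ) (p : ℕ+ × ℕ+) :
    A₁Term χ s z p.1 p.2 = (-1) ^ (p.2 : ℕ) * ATerm χ s z p := by
  rw [A₁Term, ATerm]; ring

theorem summable_A₁Term [NeZero k] (s : ℂ) {z : ℂ} (hz : 0 < z.im) :
    Summable fun p : ℕ+ × ℕ+ => A₁Term χ s z p.1 p.2 := by
  refine Summable.of_norm_bounded (summable_ATerm χ s hz).norm fun p => ?_
  rw [A₁Term_eq, norm_mul, norm_pow, norm_neg, norm_one, one_pow, one_mul]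

theorem ATerm_two_mul_snd (s z : ℂ) (p : ℕ+ × ℕ+) :
    ATerm χ s z (p.1, 2 * p.2) = χ 2 * ATerm χ s (2 * z) p := by
  simp only [ATerm, PNat.mul_coe, PNat.val_ofNat, Nat.cast_mul, Nat.cast_ofNat, map_mul]
  ring_nf

/-- The weight (-1)^m + 1 is 2 for even m and 0 for odd m, and doubling m amounts to doubling z. -/
theorem A₁_eq [NeZero k] (s : ℂ) {z : ℂ} (hz : 0 < z.im) :
    A₁ z s χ = 2 * χ 2 * A (2 * z) s χ - A z s χ := by
  have hs1 := summable_A₁Term χ s hz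
  have hs := summable_ATerm χ s hz
  have hinj : Function.Injective fun p : ℕ+ × ℕ+ => (p.1, 2 * p.2) := fun p q h => by
    simp only [Prod.mk.injEq, mul_right_inj] at h
    exact Prod.ext h.1 h.2
  have h1 : A₁ z s χ + A z s χ = ∑' p : ℕ+ × ℕ+, ((-1) ^ (p.2 : ℕ) + 1) * ATerm χ s z p := by
    rw [A₁, ← Summable.tsum_prod hs1, A, ← Summable.tsum_add hs1 hs]
    refine tsum_congr fun p => ?_
    rw [A₁Term_eq]; ring
  rw [← hinj.tsum_eq] at h1
  · have h2 : ∀ p : ℕ+ × ℕ+, ((-1) ^ ((2 * p.2 : ℕ+) : ℕ) + 1) * ATerm χ s z (p.1, 2 * p.2) =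
        2 * χ 2 * ATerm χ s (2 * z) p := by
      intro p
      rw [ATerm_two_mul_snd, PNat.mul_coe, PNat.val_ofNat, Even.neg_one_pow (even_two_mul _)]
      ring
    simp only [h2, tsum_mul_left] at h1
    rw [← A] at h1
    linear_combination h1
  · intro p hp
    have hev : Even (p.2 : ℕ) := by
      by_contra h
      refine hp ?_
      simp only [(Nat.not_even_iff_odd.mp h).neg_one_pow, neg_add_cancel, zero_mul]
    obtain ⟨r, hr⟩ := hev
    have hr0 : 0 < r := by have := p.2.pos; omega
    refine ⟨(p.1, ⟨r, hr0⟩), Prod.ext rfl (PNat.coe_injective ?_)⟩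
    rw [PNat.mul_coe, PNat.val_ofNat, hr, PNat.mk_coe]
    ring

/-- The embedding of index sets under which `B(z)` is a part of `A(z / 2)`. -/
def oddEmbedding (p : ℕ × ℕ+) : ℕ+ × ℕ+ := (⟨2 * p.1 + 1, Nat.succ_pos _⟩, p.2)

theorem oddEmbedding_injective : Function.Injective oddEmbedding := by
  rintro ⟨n, m⟩ ⟨n', m'⟩ h
  have h1 := congrArg (fun p : ℕ+ × ℕ+ => (p.1 : ℕ)) h
  have h2 := congrArg Prod.snd h
  simp only [oddEmbedding, PNat.mk_coe] at h1 h2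
  exact Prod.ext (by simpa using h1) h2

theorem BTerm_eq (s z : ℂ) (p : ℕ × ℕ+) :
    BTerm χ s z p.1 p.2 = ATerm χ s (z / 2) (oddEmbedding p) := by
  simp only [BTerm, ATerm, oddEmbedding, PNat.mk_coe]
  rw [mul_comm (χ ((p.2 : ℕ) : ZMod k))]
  congr 2
  ring

theorem summable_BTerm [NeZero k] (s : ℂ) {z : ℂ} (hz : 0 < z.im) :
    Summable fun p : ℕ × ℕ+ => BTerm χ s z p.1 p.2 := by
  have hz2 : 0 < (z / 2).im := by
    rw [div_ofNat_im]; exact half_pos hz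
  simp only [BTerm_eq]
  exact (summable_ATerm χ s hz2).comp_injective oddEmbedding_injective

theorem ATerm_two_mul_fst (s z : ℂ) (p : ℕ+ × ℕ+) :
    ATerm χ s (z / 2) (2 * p.1, p.2) = χ 2 * 2 ^ (s - 1) * ATerm χ s z p := by
  have h : ((2 : ℕ) * (p.1 : ℕ) : ℂ) ^ (s - 1) = 2 ^ (s - 1) * ((p.1 : ℕ) : ℂ) ^ (s - 1) := by
    rw [natCast_mul_natCast_cpow]; simp
  simp only [Nat.cast_ofNat] at h
  simp only [ATerm, PNat.mul_coe, PNat.val_ofNat, Nat.cast_mul, Nat.cast_ofNat, map_mul, h]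
  rw [show 2 * Real.pi * I * ((p.2 : ℕ) : ℂ) * (2 * ((p.1 : ℕ) : ℂ)) * (z / 2) / k =
    2 * Real.pi * I * ((p.2 : ℕ) : ℂ) * ((p.1 : ℕ) : ℂ) * z / k by ring]
  ring

/-- The odd n are all n without the even ones; doubling n at z/2 gives back the term at z times
χ(2)2^{s-1}. -/
theorem B_eq [NeZero k] (s : ℂ) {z : ℂ} (hz : 0 < z.im) :
    B z s χ = A (z / 2) s χ - χ 2 * 2 ^ (s - 1) * A z s χ := by
  have hz2 : 0 < (z / 2).im := by
    rw [div_ofNat_im]; exact half_pos hz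
  have hs := summable_ATerm χ s hz2
  have hinj : Function.Injective fun p : ℕ+ × ℕ+ => (2 * p.1, p.2) := fun p q h => by
    simp only [Prod.mk.injEq, mul_right_inj] at h
    exact Prod.ext h.1 h.2
  have hcompl : range (fun p : ℕ+ × ℕ+ => (2 * p.1, p.2)) = (range oddEmbedding)ᶜ := by
    ext ⟨n, m⟩
    constructor
    · rintro ⟨p, hp⟩ ⟨q, hq⟩
      have h1 := congrArg (fun p : ℕ+ × ℕ+ => (p.1 : ℕ)) (hp.trans hq.symm)
      simp only [oddEmbedding, PNat.mul_coe, PNat.val_ofNat, PNat.mk_coe] at h1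
      omega
    · intro h
      rcases Nat.even_or_odd' (n : ℕ) with ⟨r, hr | hr⟩
      · have hr0 : 0 < r := by have := n.pos; omega
        refine ⟨(⟨r, hr0⟩, m), Prod.ext (PNat.coe_injective ?_) rfl⟩
        rw [PNat.mul_coe, PNat.val_ofNat, hr, PNat.mk_coe]
      · exact absurd ⟨(r, m), Prod.ext (PNat.coe_injective hr.symm) rfl⟩ h
  have h1 := hs.tsum_subtype_add_tsum_subtype_compl (range oddEmbedding)
  rw [← hcompl, tsum_range _ oddEmbedding_injective, tsum_range _ hinj] at h1
  simp only [ATerm_two_mul_fst, ← BTerm_eq, tsum_mul_left] at h1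
  rw [Summable.tsum_prod (summable_BTerm χ s hz), ← A, ← A, ← B] at h1
  linear_combination h1

end Halving

/-! ### The transformation law of A. -/

section Transformation

theorem fIntegrand_eq {k : ℕ} {z s : ℂ} {c d : ℤ} (j : ℤ) (μ ν : ℕ) :
    fIntegrand k z s c d j μ ν = fun u => kernel k ((c : ℂ) * z + d) (((μ : ℝ) * c + j) / c)
      (ν + Int.fract ((d : ℝ) * j / c)) u * exp ((s - 1) * branchLog u) := by
  funext u
  rw [fIntegrand, kernel]
  congr 4
  · push_cast
    ring_nf
  · push_cast
    ring_nf

theorem isLoopKernel_fIntegrand {k : ℕ} (hk : 0 < k) {z : ℂ} {c d : ℤ} (hc : 0 < c)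
    (hw : 0 < ((c : ℂ) * z + d).re) {δ : ℝ} (hδ : IsLoopWidth k ((c : ℂ) * z + d) δ) {j : ℤ}
    (hj : 1 ≤ j) (μ : ℕ) {ν : ℕ} (hν : ν < k) :
    IsLoopKernel δ (kernel k ((c : ℂ) * z + d) (((μ : ℝ) * c + j) / c)
      (ν + Int.fract ((d : ℝ) * j / c))) := by
  have hc' : (0 : ℝ) < c := by exact_mod_cast hc
  have hj' : (1 : ℝ) ≤ j := by exact_mod_cast hj
  refine isLoopKernel_kernel hk hw (by positivity) ?_ hδ
  have h1 := Int.fract_lt_one ((d : ℝ) * j / c)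
  have h2 : (ν : ℝ) + 1 ≤ k := by exact_mod_cast hν
  linarith

theorem f_eq {k : ℕ} (hk : 0 < k) {z s : ℂ} (hs : 3 < s.re) {c d : ℤ} (hc : 0 < c)
    (hw : 0 < ((c : ℂ) * z + d).re) {δ : ℝ} (hδ : IsLoopWidth k ((c : ℂ) * z + d) δ) {j : ℤ}
    (hj : 1 ≤ j) (μ : ℕ) {ν : ℕ} (hν : ν < k) :
    f k δ z s c d j μ ν = -((exp (2 * Real.pi * I * s) - 1) * Gamma s) *
      ∑' p : ℕ × ℕ, kernelExponent k ((c : ℂ) * z + d) (((μ : ℝ) * c + j) / c)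
        (ν + Int.fract ((d : ℝ) * j / c)) p ^ (-s) := by
  have hc' : (0 : ℝ) < c := by exact_mod_cast hc
  have hj' : (1 : ℝ) ≤ j := by exact_mod_cast hj
  have h1 := Int.fract_lt_one ((d : ℝ) * j / c)
  have h2 : (ν : ℝ) + 1 ≤ k := by exact_mod_cast hν
  rw [f, fIntegrand_eq, (isLoopKernel_fIntegrand hk hc hw hδ hj μ hν).loopIntegral_eq hs,
    integral_kernel_mul_cpow hk hw (by positivity) (by positivity) (by linarith) (by linarith)]
  ring

variable {k : ℕ} [NeZero k] {χ ψ : DirichletCharacter ℂ k}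

/-- The sum of loop integrals in the transformation formula of the series `A`. -/
noncomputable def loopSum (ψ : DirichletCharacter ℂ k) (δ : ℝ) (z s : ℂ) (c d : ℤ) : ℂ :=
  ∑ j ∈ Finset.Icc 1 c, ∑ μ ∈ Finset.range k, ∑ ν ∈ Finset.range k,
    ψ (((μ : ℤ) * c + j : ℤ) : ZMod k) *
    star ψ ((⌊(d : ℝ) * j / c⌋ + d * (μ : ℤ) - (ν : ℤ) : ℤ) : ZMod k) * f k δ z s c d j μ ν

theorem loopSum_eq (ψ : DirichletCharacter ℂ k) {z s : ℂ} (hs : 3 < s.re) {c d : ℤ} (hc : 0 < c)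
    (hz : z ∈ quarterPlane c d) {δ : ℝ} (hδ : IsLoopWidth k ((c : ℂ) * z + d) δ) :
    loopSum ψ δ z s c d = -((exp (2 * Real.pi * I * s) - 1) * Gamma s) * coneSum ψ s z c d := by
  rw [← sum_tsum_kernelExponent ψ hc d (by linarith) hz.2, loopSum, Finset.mul_sum]
  refine Finset.sum_congr rfl fun j hj => ?_
  rw [Finset.mul_sum]
  refine Finset.sum_congr rfl fun μ _ => ?_
  rw [Finset.mul_sum]
  refine Finset.sum_congr rfl fun ν hν => ?_
  rw [f_eq (NeZero.pos k) hs hc (re_denom_pos hc hz) hδ (Finset.mem_Icc.mp hj).1 μ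
    (Finset.mem_range.mp hν)]
  ring

theorem differentiable_loopSum (ψ : DirichletCharacter ℂ k) {z : ℂ} {c d : ℤ} (hc : 0 < c)
    (hz : z ∈ quarterPlane c d) {δ : ℝ} (hδ : IsLoopWidth k ((c : ℂ) * z + d) δ) :
    Differentiable ℂ fun s => loopSum ψ δ z s c d := by
  unfold loopSum
  refine Differentiable.fun_sum fun j hj => Differentiable.fun_sum fun μ _ =>
    Differentiable.fun_sum fun ν hν => Differentiable.const_mul ?_ _
  simp only [f, fIntegrand_eq]
  exact (isLoopKernel_fIntegrand (NeZero.pos k) hc (re_denom_pos hc hz) hδ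
    (Finset.mem_Icc.mp hj).1 μ (Finset.mem_range.mp hν)).differentiable_loopIntegral

/-- The transformation formula of the series `A`. -/
theorem A_transformation (hχ : χ.IsPrimitive) (hψ : ψ.IsPrimitive) {a b c d : ℤ}
    (hdet : a * d - b * c = 1) (hc : 0 < c) {z : ℂ} (hz : z ∈ quarterPlane c d) {κ : ℂ}
    (hκ : ∀ M N : ℤ, χ ((M * d - N * c : ℤ) : ZMod k) * star χ ((N * a - M * b : ℤ) : ZMod k) =
      κ * (ψ (M : ZMod k) * star ψ (N : ZMod k)))
    (h0 : ψ 0 = 0)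
    (hv : ∀ M N : ℤ, c * N = d * M → ψ (M : ZMod k) * star ψ (N : ZMod k) = 0)
    {δ : ℝ} (hδ : IsLoopWidth k ((c : ℂ) * z + d) δ) (s : ℂ) :
    gauss (star χ) * ((c : ℂ) * z + d) ^ (-s) *
        ((1 + exp (Real.pi * I * s)) * A (moebius a b c d z) s χ) =
      κ * gauss (star ψ) * ((1 + exp (Real.pi * I * s)) * A z s ψ) +
      κ * (-(k : ℂ) / (2 * Real.pi * I)) ^ s * exp (-Real.pi * I * s) * loopSum ψ δ z s c d := by
  have hT := im_moebius_pos hdet hc hz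
  have hw0 : (c : ℂ) * z + d ≠ 0 := by
    intro h
    have := im_denom_pos hc hz
    rw [h] at this
    simp at this
  have hb0 : -(k : ℂ) / (2 * Real.pi * I) ≠ 0 := by
    simp [NeZero.ne k, Real.pi_ne_zero]
  have hA1 := differentiable_A χ hT
  have hA2 := differentiable_A ψ hz.2
  have hS := differentiable_loopSum ψ hc hz hδ
  have hp1 : Differentiable ℂ fun s : ℂ => ((c : ℂ) * z + d) ^ (-s) := fun s =>
    (differentiableAt_id.neg).const_cpow (Or.inl hw0)
  have hp2 : Differentiable ℂ fun s : ℂ => (-(k : ℂ) / (2 * Real.pi * I)) ^ s := fun s =>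
    differentiableAt_id.const_cpow (Or.inl hb0)
  have hL : Differentiable ℂ fun s => gauss (star χ) * ((c : ℂ) * z + d) ^ (-s) *
        ((1 + exp (Real.pi * I * s)) * A (moebius a b c d z) s χ) := by fun_prop
  have hR : Differentiable ℂ fun s => κ * gauss (star ψ) * ((1 + exp (Real.pi * I * s)) * A z s ψ) +
      κ * (-(k : ℂ) / (2 * Real.pi * I)) ^ s * exp (-Real.pi * I * s) * loopSum ψ δ z s c d := by
    fun_prop
  have hopen : IsOpen {s : ℂ | 3 < s.re} := isOpen_lt continuous_const continuous_re
  -- Both sides are entire in s, so the identity near s = 4, inside Re s > 3, suffices.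
  refine congrFun (AnalyticOnNhd.eq_of_eventuallyEq (z₀ := 4)
    (fun s _ => hL.analyticAt s) (fun s _ => hR.analyticAt s) ?_) s
  filter_upwards [hopen.mem_nhds (by rw [mem_ofPred_eq]; norm_num)] with s hs
  have e1 := gauss_mul_A hχ (by linarith : 2 < s.re) hT
  have e2 := gauss_mul_A hψ (by linarith : 2 < s.re) hz.2
  have e3 := halfSum_moebius hdet hc hz (by linarith : 2 < s.re) hκ h0 hv
  have e4 : exp (2 * Real.pi * I * s) = exp (Real.pi * I * s) * exp (Real.pi * I * s) := by
    rw [← Complex.exp_add]; ring_nf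
  have e5 : exp (-Real.pi * I * s) * exp (Real.pi * I * s) = 1 := by
    rw [← Complex.exp_add]; simp
  rw [loopSum_eq ψ hs hc hz hδ, e4]
  generalize exp (Real.pi * I * s) = E at *
  generalize exp (-Real.pi * I * s) = E' at *
  generalize (-(k : ℂ) / (2 * Real.pi * I)) ^ s = P at *
  generalize ((c : ℂ) * z + d) ^ (-s) = W at *
  -- The cone terms agree because E E' = 1 gives (1 + E)(E' - 1) = -E'(E² - 1), and E² - 1 is the
  -- factor carried by the loop integrals.
  linear_combination (W * (1 + E)) * e1 - κ * (1 + E) * e2 + (1 + E) * Gamma s * P * e3 +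
    κ * Gamma s * P * coneSum ψ s z c d * (1 + E) * e5

end Transformation

/-! ### The halved matrix, and characters under the congruence conditions. -/

theorem two_mul_moebius (a b c d : ℤ) (hd : Even d) (z : ℂ) :
    2 * moebius a b c d z = moebius (2 * a) b c (d / 2) (z / 2) := by
  obtain ⟨e, rfl⟩ := hd
  rw [show (e + e) / 2 = e by omega, moebius, moebius, ← mul_div_mul_left _ _ two_ne_zero,
    ← mul_div_assoc, ← mul_div_mul_left (_ * (z / 2) + _) _ two_ne_zero]
  rw [mul_div_mul_left _ _ two_ne_zero]
  congr 1 <;> push_cast <;> ring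

theorem div_two_mem_quarterPlane {c d : ℤ} (hd : Even d) {z : ℂ} (hz : z ∈ quarterPlane c d) :
    z / 2 ∈ quarterPlane c (d / 2) := by
  obtain ⟨e, rfl⟩ := hd
  rw [show (e + e) / 2 = e by omega]
  obtain ⟨h1, h2⟩ := hz
  refine ⟨?_, by rw [div_ofNat_im]; exact half_pos h2⟩
  rw [div_ofNat_re, lt_div_iff₀ two_pos]
  rwa [show -(e : ℝ) / c * 2 = -((e + e : ℤ) : ℝ) / c by push_cast; ring]

theorem denom_div_two (c d : ℤ) (hd : Even d) (z : ℂ) :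
    (c : ℂ) * (z / 2) + ((d / 2 : ℤ) : ℂ) = (c * z + d) / 2 := by
  obtain ⟨e, rfl⟩ := hd
  rw [show (e + e) / 2 = e by omega]
  push_cast
  ring

theorem floor_div_two (c d j : ℤ) (hd : Even d) :
    ⌊((d / 2 : ℤ) : ℝ) * j / c⌋ = ⌊(d : ℝ) * j / (2 * c)⌋ := by
  obtain ⟨e, rfl⟩ := hd
  rw [show (e + e) / 2 = e by omega, show ((e + e : ℤ) : ℝ) = 2 * e by push_cast; ring, mul_assoc,
    mul_div_mul_left _ _ two_ne_zero]

section Characters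

variable {k : ℕ} {χ : DirichletCharacter ℂ k}

theorem nontrivial_zmod_of_ne_one (hχ : χ ≠ 1) : Nontrivial (ZMod k) := by
  by_contra h
  rw [not_nontrivial_iff_subsingleton] at h
  exact hχ (MulChar.ext fun u => by
    rw [Subsingleton.elim u 1, Units.val_one, map_one, map_one])

/-- A nonprincipal character excludes the modulus 1, where 0 is a unit. -/
theorem apply_zero_of_ne_one (hχ : χ ≠ 1) : χ 0 = 0 := by
  have := nontrivial_zmod_of_ne_one hχ
  exact MulChar.map_zero χ

theorem mul_star_apply (χ : DirichletCharacter ℂ k) {x : ZMod k} (hx : IsUnit x) :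
    χ x * star χ x = 1 := by
  rw [MulChar.star_eq_inv, ← MulChar.mul_apply, mul_inv_cancel, MulChar.one_apply hx]

theorem star_ne_one (hχ : χ ≠ 1) : star χ ≠ 1 := by
  rwa [MulChar.star_eq_inv, inv_ne_one]

theorem isUnit_two (hk : Odd k) : IsUnit (2 : ZMod k) := by
  rw [show (2 : ZMod k) = ((2 : ℕ) : ZMod k) by simp, ZMod.isUnit_iff_coprime]
  exact Nat.coprime_two_left.mpr hk

end Characters

section Cases

variable {k : ℕ} [NeZero k] {χ : DirichletCharacter ℂ k}

/-- The character factor becomes χ(-Nc)χ̄(-Mb): M and N exchange roles, whence ψ = χ̄. As bc ≡ -1, c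
is invertible and cN = dM forces N ≡ 0. -/
theorem A_transformation_of_dvd_diag (hprim : χ.IsPrimitive) (hχ : χ ≠ 1) {a b c d : ℤ}
    (hdet : a * d - b * c = 1) (hc : 0 < c) {z : ℂ} (hz : z ∈ quarterPlane c d)
    (ha : (a : ZMod k) = 0) (hd : (d : ZMod k) = 0)
    {δ : ℝ} (hδ : IsLoopWidth k ((c : ℂ) * z + d) δ) (s : ℂ) :
    gauss (star χ) * ((c : ℂ) * z + d) ^ (-s) *
        ((1 + exp (Real.pi * I * s)) * A (moebius a b c d z) s χ) =
      star χ b * χ c * gauss χ * ((1 + exp (Real.pi * I * s)) * A z s (star χ)) +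
      star χ b * χ c * (-(k : ℂ) / (2 * Real.pi * I)) ^ s * exp (-Real.pi * I * s) *
        loopSum (star χ) δ z s c d := by
  have hbc : (b : ZMod k) * c = -1 := by
    have := congrArg (Int.cast : ℤ → ZMod k) hdet
    push_cast at this
    rw [ha] at this
    linear_combination -this
  have h := A_transformation (ψ := star χ) (κ := star χ b * χ c) hprim (star_isPrimitive hprim)
    hdet hc hz ?_ (apply_zero_of_ne_one (star_ne_one hχ)) ?_ hδ s
  · rwa [star_star] at h
  · intro M N
    push_cast
    rw [ha, hd, star_star, mul_zero, zero_sub, mul_zero, zero_sub, ← neg_one_mul, map_mul,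
      ← neg_one_mul (_ * (b : ZMod k)), map_mul, map_mul, map_mul]
    linear_combination (χ N * χ c * (star χ M * star χ b)) *
      mul_star_apply χ (isUnit_one.neg)
  · intro M N hMN
    have h1 : (N : ZMod k) = 0 := by
      have := congrArg (Int.cast : ℤ → ZMod k) hMN
      push_cast at this
      rw [hd] at this
      linear_combination (-(b : ZMod k)) * this + (N : ZMod k) * hbc
    rw [h1, star_star, apply_zero_of_ne_one hχ, mul_zero]

/-- The character factor becomes χ(Md)χ̄(Na), whence ψ = χ. As ad ≡ 1, cN = dM forces M ≡ 0. -/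
theorem A_transformation_of_dvd_antidiag (hprim : χ.IsPrimitive) (hχ : χ ≠ 1) {a b c d : ℤ}
    (hdet : a * d - b * c = 1) (hc : 0 < c) {z : ℂ} (hz : z ∈ quarterPlane c d)
    (hb : (b : ZMod k) = 0) (hc0 : (c : ZMod k) = 0)
    {δ : ℝ} (hδ : IsLoopWidth k ((c : ℂ) * z + d) δ) (s : ℂ) :
    gauss (star χ) * ((c : ℂ) * z + d) ^ (-s) *
        ((1 + exp (Real.pi * I * s)) * A (moebius a b c d z) s χ) =
      star χ a * χ d * gauss (star χ) * ((1 + exp (Real.pi * I * s)) * A z s χ) +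
      star χ a * χ d * (-(k : ℂ) / (2 * Real.pi * I)) ^ s * exp (-Real.pi * I * s) *
        loopSum χ δ z s c d := by
  have had : (a : ZMod k) * d = 1 := by
    have := congrArg (Int.cast : ℤ → ZMod k) hdet
    push_cast at this
    rw [hb] at this
    linear_combination this
  refine A_transformation (ψ := χ) hprim hprim hdet hc hz ?_ (apply_zero_of_ne_one hχ) ?_ hδ s
  · intro M N
    push_cast
    rw [hb, hc0, mul_zero, sub_zero, mul_zero, sub_zero, map_mul, map_mul]
    ring
  · intro M N hMN
    have h1 : (M : ZMod k) = 0 := by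
      have := congrArg (Int.cast : ℤ → ZMod k) hMN
      push_cast at this
      rw [hc0] at this
      linear_combination (-(a : ZMod k)) * this - (M : ZMod k) * had
    rw [h1, apply_zero_of_ne_one hχ, zero_mul]

end Cases

theorem loopSum_sub {k : ℕ} (ψ : DirichletCharacter ℂ k) (α : ℂ) (δ δ' : ℝ) (z s : ℂ) (c d : ℤ)
    (hd : Even d) :
    α * loopSum ψ δ' (z / 2) s c (d / 2) - loopSum ψ δ z s c d =
      ∑ j ∈ Finset.Icc 1 c, ∑ μ ∈ Finset.range k, ∑ ν ∈ Finset.range k,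
        ψ (((μ : ℤ) * c + j : ℤ) : ZMod k) *
        (α * star ψ ((⌊(d : ℝ) * j / (2 * c)⌋ + (d / 2) * (μ : ℤ) - (ν : ℤ) : ℤ) : ZMod k) *
            f k δ' (z / 2) s c (d / 2) j μ ν
          - star ψ ((⌊(d : ℝ) * j / c⌋ + d * (μ : ℤ) - (ν : ℤ) : ℤ) : ZMod k) *
            f k δ z s c d j μ ν) := by
  rw [loopSum, loopSum, Finset.mul_sum, ← Finset.sum_sub_distrib]
  refine Finset.sum_congr rfl fun j _ => ?_
  rw [Finset.mul_sum, ← Finset.sum_sub_distrib]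
  refine Finset.sum_congr rfl fun μ _ => ?_
  rw [Finset.mul_sum, ← Finset.sum_sub_distrib]
  refine Finset.sum_congr rfl fun ν _ => ?_
  rw [floor_div_two c d j hd]
  ring

theorem div_two_cpow {w : ℂ} (s : ℂ) : (w / 2) ^ (-s) = 2 ^ s * w ^ (-s) := by
  simpa using div_natCast_cpow_neg (k := 2) w s

theorem two_cpow_one_sub (s : ℂ) : (2 : ℂ) ^ (1 - s) * 2 ^ s = 2 := by
  rw [← cpow_add _ _ two_ne_zero, sub_add_cancel, cpow_one]

theorem two_cpow_one_sub' (s : ℂ) : (2 : ℂ) ^ (1 - s) * 2 ^ (s - 1) = 1 := by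
  rw [← cpow_add _ _ two_ne_zero, sub_add_sub_cancel', sub_self, cpow_zero]

end CharTheta

/-! ### Assembly of the two cases. -/

theorem mainTheorem8 (k : ℕ) [NeZero k] (hk : Odd k) (χ : DirichletCharacter ℂ k)
    (hprim : χ.IsPrimitive) (hχ : χ ≠ 1) (a b c d : ℤ) (hdet : a * d - b * c = 1) (hc : 0 < c)
    (hd : Even d) (z : ℂ) (hz : z ∈ CharTheta.quarterPlane c d) (s : ℂ) (δ δ' : ℝ)
    (hδ : CharTheta.IsLoopWidth k ((c : ℂ) * z + d) δ)
    (hδ' : CharTheta.IsLoopWidth k ((c : ℂ) * (z / 2) + ((d / 2 : ℤ) : ℂ)) δ') :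
    -- absolute convergence of the series and of the integrals
    (Summable (fun p : ℕ+ × ℕ+ => CharTheta.A₁Term χ s (CharTheta.moebius a b c d z) p.1 p.2) ∧
      Summable (fun p : ℕ × ℕ+ => CharTheta.BTerm χ s z p.1 p.2) ∧
      Summable (fun p : ℕ × ℕ+ => CharTheta.BTerm (star χ) s z p.1 p.2) ∧
      ∀ j ∈ Finset.Icc 1 c, ∀ μ ∈ Finset.range k, ∀ ν ∈ Finset.range k,
        CharTheta.LoopIntegrable δ (CharTheta.fIntegrand k z s c d j μ ν) ∧
        CharTheta.LoopIntegrable δ' (CharTheta.fIntegrand k (z / 2) s c (d / 2) j μ ν)) ∧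
    -- the case a ≡ d ≡ 0 (mod k)
    (a ≡ 0 [ZMOD k] → d ≡ 0 [ZMOD k] →
      CharTheta.gauss (star χ) * ((c : ℂ) * z + d) ^ (-s) *
          CharTheta.H₁ (CharTheta.moebius a b c d z) s χ =
        star χ (b : ZMod k) * χ (c : ZMod k) * CharTheta.gauss χ * (2 : ℂ) ^ (1 - s) *
            χ (2 : ZMod k) * CharTheta.B₁ z s (star χ)
        + star χ (b : ZMod k) * χ (c : ZMod k) *
            (-(k : ℂ) / (2 * Real.pi * Complex.I)) ^ s * Complex.exp (-Real.pi * Complex.I * s) *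
          ∑ j ∈ Finset.Icc 1 c, ∑ μ ∈ Finset.range k, ∑ ν ∈ Finset.range k,
            star χ (((μ : ℤ) * c + j : ℤ) : ZMod k) *
            (χ (2 : ZMod k) / (2 : ℂ) ^ (s - 1) *
                χ ((⌊(d : ℝ) * j / (2 * c)⌋ - (ν : ℤ) : ℤ) : ZMod k) *
                CharTheta.f k δ' (z / 2) s c (d / 2) j μ ν
              - χ ((⌊(d : ℝ) * j / c⌋ - (ν : ℤ) : ℤ) : ZMod k) *
                CharTheta.f k δ z s c d j μ ν)) ∧
    -- the case b ≡ c ≡ 0 (mod k)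
    (b ≡ 0 [ZMOD k] → c ≡ 0 [ZMOD k] →
      CharTheta.gauss (star χ) * ((c : ℂ) * z + d) ^ (-s) *
          CharTheta.H₁ (CharTheta.moebius a b c d z) s χ =
        star χ (a : ZMod k) * χ (d : ZMod k) * CharTheta.gauss (star χ) * (2 : ℂ) ^ (1 - s) *
            star χ (2 : ZMod k) * CharTheta.B₁ z s χ
        + star χ (a : ZMod k) * χ (d : ZMod k) *
            (-(k : ℂ) / (2 * Real.pi * Complex.I)) ^ s * Complex.exp (-Real.pi * Complex.I * s) *
          ∑ j ∈ Finset.Icc 1 c, ∑ μ ∈ Finset.range k, ∑ ν ∈ Finset.range k,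
            χ (j : ZMod k) *
            (star χ (2 : ZMod k) * (2 : ℂ) ^ (1 - s) *
                star χ ((⌊(d : ℝ) * j / (2 * c)⌋ + (d / 2) * (μ : ℤ) - (ν : ℤ) : ℤ) : ZMod k) *
                CharTheta.f k δ' (z / 2) s c (d / 2) j μ ν
              - star χ ((⌊(d : ℝ) * j / c⌋ + d * (μ : ℤ) - (ν : ℤ) : ℤ) : ZMod k) *
                CharTheta.f k δ z s c d j μ ν)) := by
  have hkpos : 0 < k := NeZero.pos k
  have hzi : 0 < z.im := hz.2
  have hTi := CharTheta.im_moebius_pos hdet hc hz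
  have hz' := CharTheta.div_two_mem_quarterPlane hd hz
  have hdet' : 2 * a * (d / 2) - b * c = 1 := by
    rw [mul_comm 2 a, mul_assoc, Int.mul_ediv_cancel' hd.two_dvd, hdet]
  have h2 := CharTheta.mul_star_apply χ (CharTheta.isUnit_two hk)
  have hW := CharTheta.denom_div_two c d hd z
  have hT := CharTheta.two_mul_moebius a b c d hd z
  have hP := CharTheta.two_cpow_one_sub s
  have hP' := CharTheta.two_cpow_one_sub' s
  have h2d : (2 : ZMod k) * ((d / 2 : ℤ) : ZMod k) = d := by
    have := congrArg (Int.cast : ℤ → ZMod k) (Int.mul_ediv_cancel' hd.two_dvd)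
    simpa using this
  refine ⟨⟨CharTheta.summable_A₁Term χ s hTi, CharTheta.summable_BTerm χ s hzi,
    CharTheta.summable_BTerm (star χ) s hzi, fun j hj μ _ ν hν => ?_⟩, fun ha hd0 => ?_,
    fun hb hc0 => ?_⟩
  · rw [Finset.mem_Icc] at hj
    rw [Finset.mem_range] at hν
    rw [CharTheta.fIntegrand_eq, CharTheta.fIntegrand_eq]
    exact ⟨(CharTheta.isLoopKernel_fIntegrand hkpos hc (CharTheta.re_denom_pos hc hz) hδ hj.1 μ
        hν).loopIntegrable s,
      (CharTheta.isLoopKernel_fIntegrand hkpos hc (CharTheta.re_denom_pos hc hz') hδ' hj.1 μ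
        hν).loopIntegrable s⟩
  · have ha' : (a : ZMod k) = 0 := by
      simpa using (ZMod.intCast_eq_intCast_iff a 0 k).mpr ha
    have hd' : (d : ZMod k) = 0 := by
      simpa using (ZMod.intCast_eq_intCast_iff d 0 k).mpr hd0
    have hd2 : ((d / 2 : ℤ) : ZMod k) = 0 :=
      (CharTheta.isUnit_two hk).mul_left_cancel (by rw [h2d, hd', mul_zero])
    have e1 := CharTheta.A_transformation_of_dvd_diag hprim hχ hdet hc hz ha' hd' hδ s
    have e2 := CharTheta.A_transformation_of_dvd_diag hprim hχ hdet' hc hz'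
      (by push_cast; rw [ha', mul_zero]) hd2 hδ' s
    have e3 := CharTheta.loopSum_sub (star χ) (χ 2 / 2 ^ (s - 1)) δ δ' z s c d hd
    simp only [star_star, Int.cast_sub, Int.cast_add, Int.cast_mul, hd', hd2, zero_mul,
      add_zero] at e3
    rw [← hT, hW, CharTheta.div_two_cpow] at e2
    rw [CharTheta.H₁, CharTheta.B₁, CharTheta.A₁_eq χ s hTi, CharTheta.B_eq (star χ) s hzi]
    simp only [Int.cast_sub, Int.cast_add, Int.cast_mul]
    rw [← e3]
    rw [div_eq_mul_inv (χ 2), inv_eq_of_mul_eq_one_left hP']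
    -- 2^{1-s}χ(2) times the law at z/2, minus the law at z. `hP` produces the coefficient 2 of
    -- A(2Tz) in `A₁_eq`; `hP'` and `h2` reduce 2^{1-s}χ(2) · χ̄(2)2^{s-1} to 1, as `B_eq` requires.
    linear_combination (2 ^ (1 - s) * χ 2) * e2 - e1 -
      CharTheta.gauss (star χ) * ((c : ℂ) * z + d) ^ (-s) *
        (1 + Complex.exp (Real.pi * Complex.I * s)) * χ 2 *
        CharTheta.A (2 * CharTheta.moebius a b c d z) s χ * hP +
      star χ b * χ c * CharTheta.gauss χ * (1 + Complex.exp (Real.pi * Complex.I * s)) *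
        CharTheta.A z s (star χ) * (χ 2 * star χ 2 * hP' + h2)
  · have hb' : (b : ZMod k) = 0 := by
      simpa using (ZMod.intCast_eq_intCast_iff b 0 k).mpr hb
    have hc0' : (c : ZMod k) = 0 := by
      simpa using (ZMod.intCast_eq_intCast_iff c 0 k).mpr hc0
    have e1 := CharTheta.A_transformation_of_dvd_antidiag hprim hχ hdet hc hz hb' hc0' hδ s
    have e2 := CharTheta.A_transformation_of_dvd_antidiag hprim hχ hdet' hc hz' hb' hc0' hδ' s
    have e3 := CharTheta.loopSum_sub χ (star χ 2 * 2 ^ (1 - s)) δ δ' z s c d hd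
    simp only [Int.cast_add, Int.cast_mul, hc0', mul_zero, zero_add] at e3
    rw [← hT, hW, CharTheta.div_two_cpow] at e2
    rw [CharTheta.H₁, CharTheta.B₁, CharTheta.A₁_eq χ s hTi, CharTheta.B_eq χ s hzi]
    rw [← e3]
    -- The halved matrix brings χ̄(2)² in front of χ̄(a)χ(d), and the weight 2^{1-s}χ(2) turns this
    -- into the 2^{1-s}χ̄(2) of the statement.
    have h4 : star χ ((2 * a : ℤ) : ZMod k) * χ ((d / 2 : ℤ) : ZMod k) =
        star χ 2 * star χ 2 * (star χ a * χ d) := by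
      rw [← h2d, map_mul]
      push_cast
      rw [map_mul]
      linear_combination (-(star χ 2 * star χ a * χ ((d / 2 : ℤ) : ZMod k))) * h2
    rw [h4] at e2
    linear_combination (2 ^ (1 - s) * χ 2) * e2 - e1 -
      CharTheta.gauss (star χ) * ((c : ℂ) * z + d) ^ (-s) *
        (1 + Complex.exp (Real.pi * Complex.I * s)) * χ 2 *
        CharTheta.A (2 * CharTheta.moebius a b c d z) s χ * hP +
      star χ a * χ d * CharTheta.gauss (star χ) * (1 + Complex.exp (Real.pi * Complex.I * s)) *
        CharTheta.A z s χ * (χ 2 * star χ 2 * hP' + h2) +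
      star χ a * χ d * 2 ^ (1 - s) * star χ 2 *
        (CharTheta.gauss (star χ) * (1 + Complex.exp (Real.pi * Complex.I * s)) *
            CharTheta.A (z / 2) s χ +
          (-(k : ℂ) / (2 * Real.pi * Complex.I)) ^ s * Complex.exp (-Real.pi * Complex.I * s) *
            CharTheta.loopSum χ δ' (z / 2) s c (d / 2)) * h2
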